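/- A locally convex Lie group is a group with a smooth manifold structure modelled on a Hausdorff locally convex real vector space, with smooth multiplication and inversion; here $f\colon U\to F$ is smooth if it is continuous and all its iterated directional derivatives exist and are jointly continuous maps $U\times E^j\to F$. For a complex Hilbert space $\mathcal H$ let $\mathrm{PU}(\mathcal H)=\mathrm U(\mathcal H)/\mathbb T\mathbf 1$. A unitary representation $\rho\colon G\to\mathrm U(\mathcal H)$ (a group homomorphism) is smooth if the vectors $\psi$ with smooth orbit map $g\mapsto\rho(g)\psi$ are dense in $\mathcal H$. A projective unitary representation $\overline\rho\colon G\to\mathrm{PU}(\mathcal H)$ (a group homomorphism) is smooth if the rays $[\psi]$ with smooth orbit map $g\mapsto\overline\rho(g)[\psi]$ are dense in the Hilbert manifold $\mathbb P(\mathcal H)$. Two projective unitary representations $(\overline\rho,\mathcal H)$, $(\overline\rho',\mathcal H')$ of $G$ are unitarily equivalent if there is a unitary $U\colon\mathcal H\to\mathcal H'$ with $\overline U\,\overline\rho(g)=\overline\rho'(g)\,\overline U$ for all $g\in G$. A central extension of $G$ by $\mathbb T$ is an exact sequence $1\to\mathbb T\to\widehat G\to G\to1$ of locally convex Lie groups such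 that the image of $\mathbb T$ is central and $\widehat G\to G$ is a locally trivial principal $\mathbb T$-bundle. An isomorphism of central extensions is an isomorphism $\Phi\colon\widehat G\to\widehat G'$ of locally convex Lie groups inducing the identity on $G$ and on $\mathbb T$. Let $G$ be a locally convex Lie group, not necessarily connected, and let $(\overline\rho,\mathcal H)$ be a smooth projective unitary representation of $G$. Call a pair $(G^\sharp,\widehat\rho)$ a *linearisation* of $\overline\rho$ if $\mathbb T\to G^\sharp\to G$ is a central extension of $G$ by $\mathbb T$ and $\widehat\rho\colon G^\sharp\to\mathrm U(\mathcal H)$ is a smooth unitary representation with $\widehat\rho(z)=z\mathbf 1$ for $z\in\mathbb T$ which induces $\overline\rho$, i.e. $\overline{\widehat\rho(x)}=\overline\rho(g)$ whenever $x\in G^\sharp$ lies over $g\in G$. 1. $\overline\rho$ has a linearisation. 2. Let $\mathcal H\neq0$, let $(\overline\rho',\mathcal H')$ be a smooth projective unitary representation of $G$, and let $(G^\sharp,\widehat\rho)$ and $(G^{\sharp\prime},\widehat\rho')$ be any linearisations of $\overline\rho$ and $\overline\rho'$. Then $(\overline\rho',\mathcal H')$ is unitarily equivalent to $(\overline\rho,\mathcal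 H)$ if and only if there exist a unitary $U\colon\mathcal H\to\mathcal H'$ and an isomorphism $\Phi\colon G^\sharp\to G^{\sharp\prime}$ of central extensions with $U\circ\widehat\rho(x)=\widehat\rho'(\Phi(x))\circ U$ for all $x\in G^\sharp$. -/

import Mathlib

open Set Filter Topology
open scoped LinearAlgebra.Projectivization

universe v u w w' u₁ u₂ u₃ u₄

noncomputable section

namespace LCLie

/-! ### Smooth maps between locally convex spaces -/

section Smooth

variable {E F : Type*} [AddCommGroup E] [Module ℝ E] [TopologicalSpace E]
  [AddCommGroup F] [Module ℝ F] [TopologicalSpace F]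

/-- `f` is a `C^∞`-map on the open set `U` (Bastiani, Michal, Keller): all iterated directional
derivatives `D j x (h₁, …, h_j) = (∂_{h_j} ⋯ ∂_{h_1} f)(x)` exist for `x ∈ U`, and each `D j` is
jointly continuous on `U × E^j` (for `j = 0` this is the continuity of `f`). The functions `D j`
are unique on `U × E^j` if `F` is Hausdorff, their values for `x ∉ U` are irrelevant. -/
def IsSmoothOn (U : Set E) (f : E → F) : Prop :=
  ∃ D : (j : ℕ) → E → (Fin j → E) → F,
    (∀ x ∈ U, ∀ h : Fin 0 → E, D 0 x h = f x) ∧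
    (∀ j : ℕ, ContinuousOn (fun p : E × (Fin j → E) => D j p.1 p.2) (U ×ˢ univ)) ∧
    ∀ j : ℕ, ∀ x ∈ U, ∀ (h : Fin j → E) (v : E),
      Tendsto (fun t : ℝ => t⁻¹ • (D j (x + t • v) h - D j x h)) (𝓝[≠] 0)
        (𝓝 (D (j + 1) x (Fin.snoc h v)))

end Smooth

/-! ### Manifolds modelled on locally convex spaces -/

section Manifold

/-- The product of a space with charts in `E` and a space with charts in `F`, with the product
charts in `E × F`. -/
@[reducible]
def prodCharted (E F M N : Type*) [TopologicalSpace E] [TopologicalSpace F]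
    [TopologicalSpace M] [TopologicalSpace N] [ChartedSpace E M] [ChartedSpace F N] :
    ChartedSpace (E × F) (M × N) :=
  prodChartedSpace E M F N

attribute [local instance] prodCharted

/-- A (Hausdorff) smooth manifold modelled on the locally convex space `E`, given by an atlas. -/
class LCManifold (E M : Type*) [AddCommGroup E] [Module ℝ E] [TopologicalSpace E]
    [TopologicalSpace M] [ChartedSpace E M] : Prop where
  t2 : T2Space M
  smooth_transition : ∀ e ∈ atlas E M, ∀ e' ∈ atlas E M,
    IsSmoothOn (e.symm.trans e').source (e.symm.trans e')

variable (E F : Type*) {M N : Type*} [AddCommGroup E] [Module ℝ E] [TopologicalSpace E]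
  [AddCommGroup F] [Module ℝ F] [TopologicalSpace F] [TopologicalSpace M] [TopologicalSpace N]
  [ChartedSpace E M] [ChartedSpace F N]

/-- `f` is smooth on the open set `s`: it is continuous there and smooth in all charts. -/
def IsSmoothMapOn (f : M → N) (s : Set M) : Prop :=
  ContinuousOn f s ∧ ∀ e ∈ atlas E M, ∀ e' ∈ atlas F N,
    IsSmoothOn (e.target ∩ e.symm ⁻¹' (s ∩ f ⁻¹' e'.source)) (e' ∘ f ∘ e.symm)

/-- Smooth maps between manifolds modelled on locally convex spaces. -/
def IsSmoothMap (f : M → N) : Prop :=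
  IsSmoothMapOn E F f univ

/-- Locally convex Lie groups. (That `E` is a Hausdorff locally convex space is assumed
separately, wherever this class is used.) -/
class LCLieGroup (E G : Type*) [AddCommGroup E] [Module ℝ E] [TopologicalSpace E]
    [TopologicalSpace G] [ChartedSpace E G] [Group G] : Prop extends LCManifold E G where
  smooth_mul : IsSmoothMap (E × E) E (fun p : G × G => p.1 * p.2)
  smooth_inv : IsSmoothMap E E (fun g : G => g⁻¹)

end Manifold

/-! ### Central extensions by the circle -/

/-- The model space of the circle group `Circle`, whose manifold structure is the one of
Mathlib. -/
abbrev CircleModel : Type := EuclideanSpace ℝ (Fin 1)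

section Extension

attribute [local instance] prodCharted

/-- A central extension `1 → 𝕋 → Total → G → 1` of locally convex Lie groups that is a locally
trivial (smooth) principal `𝕋`-bundle over `G`. -/
structure CentralExtension (E G : Type*) [AddCommGroup E] [Module ℝ E] [TopologicalSpace E]
    [TopologicalSpace G] [ChartedSpace E G] [Group G] where
  /-- the locally convex space on which the extension is modelled -/
  Model : Type u₂
  [addCommGroup : AddCommGroup Model]
  [module : Module ℝ Model]
  [modelTopology : TopologicalSpace Model]
  [isTopologicalAddGroup : IsTopologicalAddGroup Model]
  [continuousSMul : ContinuousSMul ℝ Model]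
  [locallyConvex : LocallyConvexSpace ℝ Model]
  [t2 : T2Space Model]
  /-- the Lie group in the middle of the exact sequence -/
  Total : Type u₁
  [group : Group Total]
  [topology : TopologicalSpace Total]
  [charted : ChartedSpace Model Total]
  [lieGroup : LCLieGroup Model Total]
  /-- the homomorphism from the circle group -/
  incl : Circle →* Total
  /-- the homomorphism onto `G` -/
  proj : Total →* G
  smooth_incl : IsSmoothMap CircleModel Model incl
  smooth_proj : IsSmoothMap Model E proj
  incl_injective : Function.Injective incl
  proj_surjective : Function.Surjective proj
  exact : proj.ker = incl.range
  central : ∀ (z : Circle) (x : Total), incl z * x = x * incl z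
  locally_trivial : ∀ g : G, ∃ φ : Bundle.Trivialization Circle (proj : Total → G),
    g ∈ φ.baseSet ∧
    (∀ x ∈ φ.source, ∀ z : Circle, φ (x * incl z) = ((φ x).1, (φ x).2 * z)) ∧
    IsSmoothMapOn Model (E × CircleModel) φ φ.source ∧
    IsSmoothMapOn (E × CircleModel) Model φ.toOpenPartialHomeomorph.symm φ.target

attribute [instance] CentralExtension.addCommGroup CentralExtension.module
  CentralExtension.modelTopology CentralExtension.isTopologicalAddGroup
  CentralExtension.continuousSMul CentralExtension.locallyConvex CentralExtension.t2
  CentralExtension.group CentralExtension.topology CentralExtension.charted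
  CentralExtension.lieGroup

/-- An isomorphism of central extensions: an isomorphism of locally convex Lie groups that induces
the identity on `G` and on the circle group. -/
structure CentralExtension.Iso {E G : Type*} [AddCommGroup E] [Module ℝ E] [TopologicalSpace E]
    [TopologicalSpace G] [ChartedSpace E G] [Group G] (X Y : CentralExtension E G) where
  toMulEquiv : X.Total ≃* Y.Total
  smooth_toFun : IsSmoothMap X.Model Y.Model toMulEquiv
  smooth_invFun : IsSmoothMap Y.Model X.Model toMulEquiv.symm
  proj_comp : ∀ x : X.Total, Y.proj (toMulEquiv x) = X.proj x
  comp_incl : ∀ z : Circle, toMulEquiv (X.incl z) = Y.incl z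

end Extension

/-! ### The projective unitary group and the projective Hilbert space -/

section Projective

variable (H : Type*) [NormedAddCommGroup H] [InnerProductSpace ℂ H]

/-- The scalar unitary operators `z ↦ z • 1`, where `z` runs through the circle group. -/
def scalarU : Circle →* (H ≃ₗᵢ[ℂ] H) where
  toFun z :=
    { LinearEquiv.smulOfNeZero ℂ H (z : ℂ) z.coe_ne_zero with
      norm_map' := fun x => by
        change ‖(z : ℂ) • x‖ = ‖x‖
        rw [norm_smul, Circle.norm_coe, one_mul] }
  map_one' := by ext x; simp
  map_mul' z w := by
    ext x
    change ((z * w : Circle) : ℂ) • x = (z : ℂ) • (w : ℂ) • x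
    rw [Circle.coe_mul, mul_smul]

@[simp]
theorem scalarU_apply (z : Circle) (x : H) : scalarU H z x = (z : ℂ) • x := rfl

/-- The subgroup `𝕋 1` of the unitary group. -/
def scalarSubgroup : Subgroup (H ≃ₗᵢ[ℂ] H) := (scalarU H).range

instance scalarSubgroup_normal : (scalarSubgroup H).Normal where
  conj_mem := by
    rintro _ ⟨z, rfl⟩ V
    refine ⟨z, ?_⟩
    ext x
    simp

/-- The projective unitary group `PU(H) = U(H) / 𝕋 1`. -/
abbrev PU : Type _ := (H ≃ₗᵢ[ℂ] H) ⧸ scalarSubgroup H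

variable {H}

/-- The action of a unitary operator on rays, `[φ] ↦ [V φ]`. -/
def rayMap (V : H ≃ₗᵢ[ℂ] H) : ℙ ℂ H → ℙ ℂ H :=
  Projectivization.map V.toLinearEquiv.toLinearMap V.injective

theorem rayMap_mk (V : H ≃ₗᵢ[ℂ] H) (φ : H) (hφ : φ ≠ 0) :
    rayMap V (Projectivization.mk ℂ φ hφ) =
      Projectivization.mk ℂ (V φ) (by simpa using hφ) := rfl

/-- The action of `PU(H)` on the projective space of `H`. -/
def PU.act (a : PU H) (p : ℙ ℂ H) : ℙ ℂ H :=
  Quotient.liftOn' a (fun V => rayMap V p) (by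
    intro V W h
    rw [QuotientGroup.leftRel_apply] at h
    obtain ⟨z, hz⟩ := h
    obtain rfl : W = V * scalarU H z := by rw [hz]; group
    induction p using Projectivization.ind with
    | h φ hφ =>
      simp only [rayMap_mk]
      rw [Projectivization.mk_eq_mk_iff']
      refine ⟨((z⁻¹ : Circle) : ℂ), ?_⟩
      simp [smul_smul])

variable {H' : Type*} [NormedAddCommGroup H'] [InnerProductSpace ℂ H']

/-- Conjugation `V ↦ U V U⁻¹` of unitary operators by a unitary transformation `U : H → H'`. -/
def conjU (U : H ≃ₗᵢ[ℂ] H') : (H ≃ₗᵢ[ℂ] H) →* (H' ≃ₗᵢ[ℂ] H') where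
  toFun V := (U.symm.trans V).trans U
  map_one' := by ext x; simp
  map_mul' V W := by ext x; simp

@[simp]
theorem conjU_apply (U : H ≃ₗᵢ[ℂ] H') (V : H ≃ₗᵢ[ℂ] H) (x : H') :
    conjU U V x = U (V (U.symm x)) := rfl

/-- The homomorphism `PU(H) → PU(H')`, `a ↦ [U] a [U]⁻¹`, induced by a unitary `U : H → H'`. -/
def PU.conj (U : H ≃ₗᵢ[ℂ] H') : PU H →* PU H' :=
  QuotientGroup.map (scalarSubgroup H) (scalarSubgroup H') (conjU U) (by
    rintro _ ⟨z, rfl⟩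
    refine ⟨z, ?_⟩
    ext x
    simp)

/-- The topology of the projective space of `H`: the quotient topology of `H ∖ {0}`. -/
instance projTopology : TopologicalSpace (ℙ ℂ H) :=
  TopologicalSpace.coinduced (Projectivization.mk' ℂ : {v : H // v ≠ 0} → ℙ ℂ H) inferInstance

/-- The domain `{[φ] : ⟪ψ, φ⟫ ≠ 0}` of the affine chart at `[ψ]`. -/
def affineDomain (ψ : H) : Set (ℙ ℂ H) := {p | inner ℂ ψ p.rep ≠ 0}

/-- The affine chart `[ψ + u] ↦ u`, from `affineDomain ψ` to the orthogonal complement of `ψ`,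
of the Hilbert manifold of rays: `[φ]` is sent to the component orthogonal to `ψ` of the vector
`(⟪ψ, ψ⟫ / ⟪ψ, φ⟫) • φ`. -/
def affineChart (ψ : H) (p : ℙ ℂ H) : (Submodule.span ℂ {ψ})ᗮ :=
  (Submodule.span ℂ {ψ})ᗮ.orthogonalProjectionOnto ((inner ℂ ψ ψ / inner ℂ ψ p.rep) • p.rep)

theorem mem_affineDomain_mk (ψ φ : H) (hφ : φ ≠ 0) :
    Projectivization.mk ℂ φ hφ ∈ affineDomain ψ ↔ inner ℂ ψ φ ≠ 0 := by
  obtain ⟨a, ha⟩ := Projectivization.exists_smul_eq_mk_rep ℂ φ hφ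
  have ha' : (a : ℂ) • φ = (Projectivization.mk ℂ φ hφ).rep := ha
  simp [affineDomain, ← ha']

theorem affineChart_mk (ψ φ : H) (hφ : φ ≠ 0) :
    affineChart ψ (Projectivization.mk ℂ φ hφ) =
      (Submodule.span ℂ {ψ})ᗮ.orthogonalProjectionOnto ((inner ℂ ψ ψ / inner ℂ ψ φ) • φ) := by
  obtain ⟨a, ha⟩ := Projectivization.exists_smul_eq_mk_rep ℂ φ hφ
  have ha' : (a : ℂ) • φ = (Projectivization.mk ℂ φ hφ).rep := ha
  have h0 : (a : ℂ) ≠ 0 := a.ne_zero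
  rw [affineChart, ← ha', inner_smul_right, smul_smul]
  congr 2
  by_cases h : inner ℂ ψ φ = 0
  · simp [h]
  · field_simp

/-- The map `u ↦ [ψ + u]` on the orthogonal complement of `ψ` is inverse to the affine chart. -/
theorem affineChart_add (ψ : H) (hψ : ψ ≠ 0) (u : (Submodule.span ℂ {ψ})ᗮ)
    (h : ψ + (u : H) ≠ 0) :
    Projectivization.mk ℂ (ψ + (u : H)) h ∈ affineDomain ψ ∧
      affineChart ψ (Projectivization.mk ℂ (ψ + (u : H)) h) = u := by
  have hu : inner ℂ ψ (u : H) = 0 := Submodule.mem_orthogonal_singleton_iff_inner_right.1 u.2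
  have hψ' : inner ℂ ψ ψ ≠ 0 := inner_self_ne_zero.2 hψ
  have h1 : inner ℂ ψ (ψ + (u : H)) = inner ℂ ψ ψ := by rw [inner_add_right, hu, add_zero]
  refine ⟨by rw [mem_affineDomain_mk, h1]; exact hψ', ?_⟩
  rw [affineChart_mk, h1, div_self hψ', one_smul, map_add]
  have h2 : (Submodule.span ℂ {ψ})ᗮ.orthogonalProjectionOnto ψ = 0 := by
    rw [Submodule.orthogonalProjectionOnto_eq_zero_iff]
    exact Submodule.le_orthogonal_orthogonal _ (Submodule.mem_span_singleton_self ψ)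
  rw [h2, zero_add, Submodule.orthogonalProjectionOnto_mem_subspace_eq_self]

/-- A map from a manifold to the Hilbert manifold of rays is smooth if it is continuous, and
smooth in all affine charts of the projective space. -/
def IsSmoothToRays (E : Type*) {M : Type*} [AddCommGroup E] [Module ℝ E] [TopologicalSpace E]
    [TopologicalSpace M] [ChartedSpace E M] (f : M → ℙ ℂ H) : Prop :=
  Continuous f ∧ ∀ e ∈ atlas E M, ∀ ψ : H, ψ ≠ 0 →
    IsSmoothOn (e.target ∩ e.symm ⁻¹' (f ⁻¹' affineDomain ψ)) (affineChart ψ ∘ f ∘ e.symm)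

end Projective

/-! ### Smooth linear and projective unitary representations -/

section Representations

variable (E : Type*) {G : Type*} [AddCommGroup E] [Module ℝ E] [TopologicalSpace E]
  [TopologicalSpace G] [ChartedSpace E G] [Group G]
  {H : Type*} [NormedAddCommGroup H] [InnerProductSpace ℂ H]
  {H' : Type*} [NormedAddCommGroup H'] [InnerProductSpace ℂ H']

/-- A unitary representation is smooth if the vectors with smooth orbit map are dense. -/
def IsSmoothRep (r : G →* (H ≃ₗᵢ[ℂ] H)) : Prop :=
  Dense {ψ : H | IsSmoothMap E H (fun g : G => r g ψ)}

/-- A projective unitary representation is smooth if the rays with smooth orbit map are dense. -/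
def IsSmoothProjRep (ρ : G →* PU H) : Prop :=
  Dense {p : ℙ ℂ H | IsSmoothToRays E (fun g : G => (ρ g).act p)}

/-- Unitary equivalence of projective unitary representations: `[U] ρ(g) = ρ'(g) [U]` for all `g`,
for some unitary transformation `U`. -/
def ProjUnitarilyEquivalent (ρ : G →* PU H) (ρ' : G →* PU H') : Prop :=
  ∃ U : H ≃ₗᵢ[ℂ] H', ∀ g : G, PU.conj U (ρ g) = ρ' g

variable {E}

/-- `r` is a smooth unitary representation of the central extension `X` with `r(z) = z 1` for
`z` in the circle group, and `ρ` is the corresponding projective unitary representation of `G`. -/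
structure CentralExtension.Linearizes (X : CentralExtension E G)
    (r : X.Total →* (H ≃ₗᵢ[ℂ] H)) (ρ : G →* PU H) : Prop where
  smooth : IsSmoothRep X.Model r
  map_incl : ∀ z : Circle, r (X.incl z) = scalarU H z
  induces : ∀ x : X.Total, ρ (X.proj x) = (r x : PU H)

end Representations

end LCLie

end

set_option linter.unusedSectionVars false

noncomputable section

namespace LCLie

/-! Existence. As a group, the extension is the pullback of `U(H) → PU(H)` along `ρ`: all pairs `(g,
V)` with `V` representing `ρ g`. Its smooth structure comes from one vector `v` spanning a smooth
ray. The map `(g, V) ↦ (g, V v)` is injective, and where `⟪χ, V v⟫ ≠ 0` the phase of this number is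
a fibre coordinate, so that charts of `G × 𝕋` become charts of the pullback (`Pullback.triv`).

A map into the pullback is then smooth as soon as its projection to `G` and one nonvanishing
coefficient `⟪χ, V v⟫` are smooth (`Pullback.mSmoothAt_of_inner`). The orbit map of `v` is smooth by
construction. If `c` spans another smooth ray and `⟪c, v⟫ ≠ 0`, its orbit map is smooth too, because
`V c` is a constant multiple of the projection of `V v` to the line of `V c`, a line that depends
smoothly on `g` alone (`Pullback.mSmoothAt_op_of_smoothRay`). Such `c` are dense
(`dense_smoothRay`). Hence the representation is smooth, and `c` can be used to test the group
operations: `⟪c, V⁻¹ v⟫ = ⟪V c, v⟫` and `⟪c, V W v⟫ = ⟪V⁻¹ c, W v⟫`.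

Equivalence. For `H ≠ 0` an element of a linearisation is determined by its image in `G` and its
operator, so a unitary `U` intertwining the projective representations leaves exactly one candidate
`Φ`, which is automatically a homomorphism. Locally `Φ` is a smooth section times a circle-valued
function, and that function is a quotient of smooth matrix coefficients
(`isSmoothMap_of_intertwines`).

Calculus. Smoothness by iterated directional derivatives is translated into a recursive notion of
`C^k` (`isSmoothOn_iff_isCk`), for which the chain rule `IsCk.comp` is an induction on `k`. Its
analytic core is strict differentiability, `tendsto_slope_of_continuousAt`, obtained from the mean
value theorem by Hahn–Banach. -/

/-! ### Directional derivatives -/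

section DirDeriv

variable {E F F' : Type*} [AddCommGroup E] [Module ℝ E] [TopologicalSpace E]
  [AddCommGroup F] [Module ℝ F] [TopologicalSpace F]
  [AddCommGroup F'] [Module ℝ F'] [TopologicalSpace F']

/-- `L` is the derivative of `f` at `x` in the direction `v`. -/
def HasDirDeriv (f : E → F) (x v : E) (L : F) : Prop :=
  Tendsto (fun t : ℝ => t⁻¹ • (f (x + t • v) - f x)) (𝓝[≠] 0) (𝓝 L)

theorem HasDirDeriv.unique [T2Space F] {f : E → F} {x v : E} {L L' : F}
    (h : HasDirDeriv f x v L) (h' : HasDirDeriv f x v L') : L = L' :=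
  tendsto_nhds_unique h h'

theorem tendsto_line [IsTopologicalAddGroup E] [ContinuousSMul ℝ E] (x v : E) :
    Tendsto (fun t : ℝ => x + t • v) (𝓝[≠] 0) (𝓝 x) := by
  have : Continuous (fun t : ℝ => x + t • v) := by fun_prop
  simpa using (this.tendsto 0).mono_left nhdsWithin_le_nhds

theorem HasDirDeriv.congr_of_eventuallyEq [IsTopologicalAddGroup E] [ContinuousSMul ℝ E]
    {f g : E → F} {x v : E} {L : F} (h : HasDirDeriv f x v L) (hfg : g =ᶠ[𝓝 x] f) :
    HasDirDeriv g x v L := by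
  refine Tendsto.congr' ?_ h
  filter_upwards [(tendsto_line x v).eventually hfg] with t ht
  rw [ht, hfg.eq_of_nhds]

theorem HasDirDeriv.const_smul_dir [ContinuousConstSMul ℝ F] {f : E → F} {x v : E} {L : F}
    (h : HasDirDeriv f x v L) (s : ℝ) : HasDirDeriv f x (s • v) (s • L) := by
  rcases eq_or_ne s 0 with rfl | hs
  · simp only [HasDirDeriv, zero_smul, smul_zero, add_zero, sub_self]
    exact tendsto_const_nhds
  · have h1 : Tendsto (fun t : ℝ => t * s) (𝓝[≠] 0) (𝓝[≠] 0) := by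
      refine tendsto_nhdsWithin_iff.2 ⟨?_, ?_⟩
      · have : Continuous (fun t : ℝ => t * s) := by fun_prop
        simpa using (this.tendsto 0).mono_left nhdsWithin_le_nhds
      · filter_upwards [self_mem_nhdsWithin] with t ht
        exact mul_ne_zero ht hs
    refine ((h.comp h1).const_smul s).congr' ?_
    filter_upwards with t
    simp only [Function.comp, smul_smul, mul_inv]
    congr 1
    field_simp

theorem HasDirDeriv.map {f : E → F} {x v : E} {L : F} (h : HasDirDeriv f x v L) (ℓ : F →L[ℝ] F') :
    HasDirDeriv (fun y => ℓ (f y)) x v (ℓ L) := by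
  refine ((ℓ.continuous.tendsto L).comp h).congr fun t => ?_
  simp

theorem HasDirDeriv.add [ContinuousAdd F] {f g : E → F} {x v : E} {L M : F}
    (hf : HasDirDeriv f x v L) (hg : HasDirDeriv g x v M) :
    HasDirDeriv (fun y => f y + g y) x v (L + M) := by
  refine (Tendsto.add hf hg).congr fun t => ?_
  rw [← smul_add, add_sub_add_comm]

theorem HasDirDeriv.const_smul [ContinuousConstSMul ℝ F] {f : E → F} {x v : E} {L : F}
    (hf : HasDirDeriv f x v L) (s : ℝ) :
    HasDirDeriv (fun y => s • f y) x v (s • L) := by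
  refine (Tendsto.const_smul hf s).congr fun t => ?_
  rw [← smul_sub, smul_comm]

theorem HasDirDeriv.prodMk {f : E → F} {g : E → F'} {x v : E} {L : F} {M : F'}
    (hf : HasDirDeriv f x v L) (hg : HasDirDeriv g x v M) :
    HasDirDeriv (fun y => (f y, g y)) x v (L, M) :=
  Filter.Tendsto.prodMk_nhds hf hg

theorem HasDirDeriv.comp_clm {E' : Type*} [AddCommGroup E'] [Module ℝ E'] [TopologicalSpace E']
    {f : E → F} (ℓ : E' →L[ℝ] E) {x v : E'} {L : F} (h : HasDirDeriv f (ℓ x) (ℓ v) L) :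
    HasDirDeriv (fun y => f (ℓ y)) x v L := by
  refine Tendsto.congr (fun t => ?_) h
  simp

end DirDeriv

/-! ### Mean value theorem and strict differentiability. -/

section MeanValue

variable {E F : Type*} [AddCommGroup E] [Module ℝ E] [TopologicalSpace E]
  [AddCommGroup F] [Module ℝ F] [TopologicalSpace F]
  [IsTopologicalAddGroup F] [ContinuousSMul ℝ F] [LocallyConvexSpace ℝ F]

/-- The mean value theorem for curves in locally convex spaces. -/
theorem sub_mem_closure_of_hasDirDeriv {c c' : ℝ → F} {W : Set F} (hW : Convex ℝ W)
    (hc : ∀ s ∈ Icc (0 : ℝ) 1, HasDirDeriv c s 1 (c' s)) (hc' : ∀ s ∈ Icc (0 : ℝ) 1, c' s ∈ W) :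
    c 1 - c 0 ∈ closure W := by
  by_contra hn
  obtain ⟨ℓ, u, h1, h2⟩ := geometric_hahn_banach_point_closed hW.closure isClosed_closure hn
  have hd : ∀ s ∈ Icc (0 : ℝ) 1, HasDerivAt (fun s => ℓ (c s)) (ℓ (c' s)) s := by
    intro s hs
    rw [hasDerivAt_iff_tendsto_slope_zero]
    simpa [HasDirDeriv] using (hc s hs).map ℓ
  obtain ⟨s, hs, he⟩ := exists_hasDerivAt_eq_slope (fun s => ℓ (c s)) (fun s => ℓ (c' s))
    zero_lt_one (fun s hs => (hd s hs).continuousAt.continuousWithinAt)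
    (fun s hs => hd s (Ioo_subset_Icc_self hs))
  have h3 := h2 (c' s) (subset_closure (hc' s (Ioo_subset_Icc_self hs)))
  rw [map_sub] at h1
  rw [he] at h3
  simp only [sub_zero, div_one] at h3
  linarith

variable [IsTopologicalAddGroup E] [ContinuousSMul ℝ E]

/-- Functions with continuous directional derivatives are strictly differentiable. -/
theorem tendsto_slope_of_continuousAt {f : E → F} {f' : E × E → F} {U : Set E} (hU : IsOpen U)
    (hf : ∀ x ∈ U, ∀ v, HasDirDeriv f x v (f' (x, v))) {x v : E} (hx : x ∈ U)
    (hf' : ContinuousAt f' (x, v)) :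
    Tendsto (fun p : ℝ × E × E => p.1⁻¹ • (f (p.2.1 + p.1 • p.2.2) - f p.2.1))
      (𝓝[≠] 0 ×ˢ 𝓝 (x, v)) (𝓝 (f' (x, v))) := by
  intro N hN
  obtain ⟨N', hN', hN'c, hN'N⟩ := exists_mem_nhds_isClosed_subset hN
  obtain ⟨W, ⟨hW, hWc⟩, hWN⟩ :=
    (LocallyConvexSpace.convex_basis (𝕜 := ℝ) (f' (x, v))).mem_iff.1 hN'
  have h1 : ∀ᶠ q : E × E in 𝓝 (x, v), q.1 ∈ U ∧ f' q ∈ W :=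
    ((continuous_fst.tendsto (x, v)).eventually (hU.mem_nhds hx)).and (hf'.eventually hW)
  -- Compactness of `[0, 1]` gives one neighbourhood that works along the whole segment.
  have h2 : ∀ᶠ p : ℝ × E × E in 𝓝 ((0 : ℝ), (x, v)), ∀ s ∈ Icc (0 : ℝ) 1,
      (p.2.1 + s • p.1 • p.2.2) ∈ U ∧ f' (p.2.1 + s • p.1 • p.2.2, p.2.2) ∈ W := by
    refine isCompact_Icc.eventually_forall_of_forall_eventually fun s _ => ?_
    have : Continuous fun q : (ℝ × E × E) × ℝ =>
      (q.1.2.1 + q.2 • q.1.1 • q.1.2.2, q.1.2.2) := by fun_prop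
    have h3 := this.tendsto ((0, (x, v)), s)
    simp only [zero_smul, smul_zero, add_zero] at h3
    exact h3.eventually h1
  have h4 : ∀ᶠ p : ℝ × E × E in 𝓝[≠] 0 ×ˢ 𝓝 (x, v), p.1 ≠ 0 :=
    (eventually_mem_nhdsWithin (a := (0 : ℝ)) (s := {0}ᶜ)).prod_inl _
  rw [nhds_prod_eq] at h2
  have h5 := h2.filter_mono (Filter.prod_mono (nhdsWithin_le_nhds (s := {0}ᶜ)) le_rfl)
  rw [mem_map]
  filter_upwards [h4, h5] with p hp0 hp
  refine hN'N ?_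
  refine hN'c.closure_subset_iff.2 hWN ?_
  -- The difference quotient is the increment over `[0, 1]` of this rescaled curve, whose velocities
  -- lie in `W`.
  have h6 := sub_mem_closure_of_hasDirDeriv (c := fun s => p.1⁻¹ • f (p.2.1 + s • p.1 • p.2.2))
    (c' := fun s => f' (p.2.1 + s • p.1 • p.2.2, p.2.2)) hWc ?_ (fun s hs => (hp s hs).2)
  · simpa [smul_sub] using h6
  · intro s hs
    have h7 := ((hf _ (hp s hs).1 p.2.2).const_smul_dir p.1).const_smul p.1⁻¹
    rw [inv_smul_smul₀ hp0] at h7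
    refine Tendsto.congr (fun t => ?_) h7
    simp only [smul_eq_mul, mul_one, add_smul, add_assoc]

/-- The step from `x` to `x + t v + t w` is split at `x + t v`. The second half has a moving base
point, which strict differentiability allows. -/
theorem HasDirDeriv.add_dir [T2Space F] {f : E → F} {f' : E × E → F} {U : Set E} (hU : IsOpen U)
    (hf : ∀ x ∈ U, ∀ v, HasDirDeriv f x v (f' (x, v))) (hf' : ContinuousOn f' (U ×ˢ univ))
    {x : E} (hx : x ∈ U) (v w : E) : f' (x, v + w) = f' (x, v) + f' (x, w) := by
  have hc : ∀ w, ContinuousAt f' (x, w) := fun w =>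
    hf'.continuousAt ((hU.prod isOpen_univ).mem_nhds ⟨hx, mem_univ _⟩)
  refine (hf x hx (v + w)).unique ?_
  have h1 := tendsto_slope_of_continuousAt hU hf hx (hc w)
  have h2 : Tendsto (fun t : ℝ => (t, x + t • v, w)) (𝓝[≠] 0) (𝓝[≠] 0 ×ˢ 𝓝 (x, w)) :=
    tendsto_id.prodMk ((tendsto_line x v).prodMk_nhds tendsto_const_nhds)
  refine (Tendsto.add (hf x hx v) (h1.comp h2)).congr fun t => ?_
  simp only [Function.comp, ← smul_add]
  congr 1
  rw [smul_add, ← add_assoc]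
  abel

/-- The quotient for `f ∘ g` is a quotient for `f` at `g x` in the moving direction `t⁻¹ (g (x + t
v) - g x)`, which tends to `L`; strict differentiability permits such a direction. -/
theorem HasDirDeriv.comp {E' : Type*} [AddCommGroup E'] [Module ℝ E'] [TopologicalSpace E']
    {f : E → F} {f' : E × E → F} {U : Set E} (hU : IsOpen U)
    (hf : ∀ x ∈ U, ∀ v, HasDirDeriv f x v (f' (x, v))) {g : E' → E} {x v : E'} {L : E}
    (hg : HasDirDeriv g x v L) (hx : g x ∈ U) (hf' : ContinuousAt f' (g x, L)) :
    HasDirDeriv (fun y => f (g y)) x v (f' (g x, L)) := by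
  have h1 := tendsto_slope_of_continuousAt hU hf hx hf'
  have h2 : Tendsto (fun t : ℝ => (t, g x, t⁻¹ • (g (x + t • v) - g x))) (𝓝[≠] 0)
      (𝓝[≠] 0 ×ˢ 𝓝 (g x, L)) :=
    tendsto_id.prodMk (tendsto_const_nhds.prodMk_nhds hg)
  refine (h1.comp h2).congr' ?_
  filter_upwards [self_mem_nhdsWithin] with t ht
  simp only [Function.comp]
  rw [smul_smul, mul_inv_cancel₀ ht, one_smul, add_sub_cancel]

end MeanValue

/-! ### Maps of class `C^k` -/

section Ck

variable {F F' : Type*} [AddCommGroup F] [Module ℝ F] [TopologicalSpace F]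
  [AddCommGroup F'] [Module ℝ F'] [TopologicalSpace F']

/-- `f` is of class `C^k` on `U`: it is continuous and, if `k > 0`, has directional derivatives
that form a map of class `C^(k - 1)` on `U × E`. -/
def IsCk : ℕ → ∀ {E : Type u} [AddCommGroup E] [Module ℝ E] [TopologicalSpace E],
    Set E → (E → F) → Prop
  | 0, _, _, _, _, U, f => ContinuousOn f U
  | k + 1, E, _, _, _, U, f => ContinuousOn f U ∧ ∃ f' : E × E → F,
      (∀ x ∈ U, ∀ v, HasDirDeriv f x v (f' (x, v))) ∧ IsCk k (U ×ˢ univ) f'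

theorem IsCk.continuousOn {k : ℕ} {E : Type u} [AddCommGroup E] [Module ℝ E] [TopologicalSpace E]
    {U : Set E} {f : E → F} (h : IsCk k U f) : ContinuousOn f U := by
  cases k with
  | zero => exact h
  | succ k => exact h.1

theorem IsCk.pred {k : ℕ} {E : Type u} [AddCommGroup E] [Module ℝ E] [TopologicalSpace E]
    {U : Set E} {f : E → F} (h : IsCk (k + 1) U f) : IsCk k U f := by
  induction k generalizing E with
  | zero => exact h.1
  | succ k ih =>
    obtain ⟨hc, f', h1, h2⟩ := h
    exact ⟨hc, f', h1, ih h2⟩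

theorem IsCk.mono {k : ℕ} {E : Type u} [AddCommGroup E] [Module ℝ E] [TopologicalSpace E]
    {U V : Set E} {f : E → F} (h : IsCk k U f) (hV : V ⊆ U) : IsCk k V f := by
  induction k generalizing E with
  | zero => exact ContinuousOn.mono h hV
  | succ k ih =>
    obtain ⟨hc, f', h1, h2⟩ := h
    exact ⟨hc.mono hV, f', fun x hx => h1 x (hV hx), ih h2 (prod_mono_left hV)⟩

theorem IsCk.prodMk {k : ℕ} {E : Type u} [AddCommGroup E] [Module ℝ E] [TopologicalSpace E]
    {U : Set E} {f : E → F} {g : E → F'} (hf : IsCk k U f) (hg : IsCk k U g) :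
    IsCk k U (fun x => (f x, g x)) := by
  induction k generalizing E with
  | zero => exact ContinuousOn.prodMk hf hg
  | succ k ih =>
    obtain ⟨hc, f', h1, h2⟩ := hf
    obtain ⟨hc', g', h1', h2'⟩ := hg
    exact ⟨hc.prodMk hc', fun p => (f' p, g' p), fun x hx v => (h1 x hx v).prodMk (h1' x hx v),
      ih h2 h2'⟩

theorem IsCk.add [ContinuousAdd F] {k : ℕ} {E : Type u} [AddCommGroup E] [Module ℝ E]
    [TopologicalSpace E] {U : Set E} {f g : E → F} (hf : IsCk k U f) (hg : IsCk k U g) :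
    IsCk k U (fun x => f x + g x) := by
  induction k generalizing E with
  | zero => exact ContinuousOn.add hf hg
  | succ k ih =>
    obtain ⟨hc, f', h1, h2⟩ := hf
    obtain ⟨hc', g', h1', h2'⟩ := hg
    exact ⟨hc.add hc', fun p => f' p + g' p, fun x hx v => (h1 x hx v).add (h1' x hx v),
      ih h2 h2'⟩

theorem isCk_clm {k : ℕ} {E : Type u} [AddCommGroup E] [Module ℝ E]
    [TopologicalSpace E] (U : Set E) (ℓ : E →L[ℝ] F) : IsCk k U ℓ := by
  induction k generalizing E with
  | zero => exact ℓ.continuous.continuousOn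
  | succ k ih =>
    refine ⟨ℓ.continuous.continuousOn, ℓ.comp (ContinuousLinearMap.snd ℝ E E), fun x _ v => ?_,
      ih _ _⟩
    refine Tendsto.congr' ?_ tendsto_const_nhds
    filter_upwards [self_mem_nhdsWithin] with t ht
    simp [inv_smul_smul₀ (show t ≠ 0 from ht)]

theorem isCk_const {k : ℕ} {E : Type u} [AddCommGroup E] [Module ℝ E]
    [TopologicalSpace E] (U : Set E) (c : F) : IsCk k U (fun _ : E => c) := by
  have h0 : ∀ (k : ℕ) {E : Type u} [AddCommGroup E] [Module ℝ E] [TopologicalSpace E] (U : Set E),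
      IsCk k U (fun _ : E => (0 : F)) := fun k E _ _ _ U => isCk_clm U (0 : E →L[ℝ] F)
  cases k with
  | zero => exact continuousOn_const
  | succ k =>
    refine ⟨continuousOn_const, fun _ => 0, fun x _ v => ?_, h0 k _⟩
    simp only [HasDirDeriv, sub_self, smul_zero]
    exact tendsto_const_nhds

theorem isCk_sum [ContinuousAdd F] {k : ℕ} {E : Type u} [AddCommGroup E] [Module ℝ E]
    [TopologicalSpace E] {U : Set E} {ι : Type*} (s : Finset ι) {f : ι → E → F}
    (hf : ∀ i ∈ s, IsCk k U (f i)) : IsCk k U (fun x => ∑ i ∈ s, f i x) := by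
  classical
  induction s using Finset.induction_on with
  | empty => simpa using isCk_const U (0 : F)
  | insert a s ha ih =>
    simp only [Finset.sum_insert ha]
    exact (hf a (Finset.mem_insert_self a s)).add
      (ih fun i hi => hf i (Finset.mem_insert_of_mem hi))

theorem IsCk.comp_clm {k : ℕ} {E : Type u} [AddCommGroup E] [Module ℝ E] [TopologicalSpace E]
    {E' : Type w} [AddCommGroup E'] [Module ℝ E'] [TopologicalSpace E']
    {U : Set E} {f : E → F} (hf : IsCk k U f) (ℓ : E' →L[ℝ] E) {V : Set E'} (hV : MapsTo ℓ V U) :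
    IsCk k V (fun x => f (ℓ x)) := by
  induction k generalizing E E' with
  | zero => exact ContinuousOn.comp hf ℓ.continuous.continuousOn hV
  | succ k ih =>
    obtain ⟨hc, f', h1, h2⟩ := hf
    exact ⟨hc.comp ℓ.continuous.continuousOn hV, fun p => f' (ℓ.prodMap ℓ p),
      fun x hx v => (h1 (ℓ x) (hV hx) (ℓ v)).comp_clm ℓ,
      ih h2 (ℓ.prodMap ℓ) fun p hp => ⟨hV hp.1, mem_univ _⟩⟩

/-- The chain rule. -/
theorem IsCk.comp [IsTopologicalAddGroup F] [ContinuousSMul ℝ F] [LocallyConvexSpace ℝ F]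
    {k : ℕ} {E : Type u} [AddCommGroup E] [Module ℝ E] [TopologicalSpace E]
    [IsTopologicalAddGroup E] [ContinuousSMul ℝ E]
    {E' : Type w} [AddCommGroup E'] [Module ℝ E'] [TopologicalSpace E']
    {V : Set E} (hVo : IsOpen V) {g : E → F} (hg : IsCk k V g) {U : Set E'} {f : E' → E}
    (hf : IsCk k U f) (hfV : MapsTo f U V) : IsCk k U (fun x => g (f x)) := by
  induction k generalizing E E' with
  | zero => exact ContinuousOn.comp hg hf hfV
  | succ k ih =>
    have hf0 := hf.pred
    obtain ⟨hc, f', h1, h2⟩ := hf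
    obtain ⟨hc', g', h1', h2'⟩ := hg
    have hVo' : IsOpen (V ×ˢ (univ : Set E)) := hVo.prod isOpen_univ
    refine ⟨hc'.comp hc hfV, fun p => g' (f p.1, f' p), fun x hx v => ?_,
      ih hVo' h2' (f := fun p => (f p.1, f' p)) ?_ fun p hp => ⟨hfV hp.1, mem_univ _⟩⟩
    · exact HasDirDeriv.comp hVo h1' (h1 x hx v) (hfV hx)
        (h2'.continuousOn.continuousAt (hVo'.mem_nhds ⟨hfV hx, mem_univ _⟩))
    · exact (hf0.comp_clm (ContinuousLinearMap.fst ℝ E' E') fun p hp => hp.1).prodMk h2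

theorem IsCk.congr {k : ℕ} {E : Type u} [AddCommGroup E] [Module ℝ E] [TopologicalSpace E]
    [IsTopologicalAddGroup E] [ContinuousSMul ℝ E] {U : Set E} (hU : IsOpen U) {f g : E → F}
    (hf : IsCk k U f) (hfg : EqOn g f U) : IsCk k U g := by
  cases k with
  | zero => exact ContinuousOn.congr hf hfg
  | succ k =>
    obtain ⟨hc, f', h1, h2⟩ := hf
    exact ⟨hc.congr hfg, f', fun x hx v =>
      (h1 x hx v).congr_of_eventuallyEq (hfg.eventuallyEq_of_mem (hU.mem_nhds hx)), h2⟩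

theorem isCk_of_contDiffOn {k : ℕ} {E : Type u} [NormedAddCommGroup E] [NormedSpace ℝ E]
    {N : Type*} [NormedAddCommGroup N] [NormedSpace ℝ N] {U : Set E} (hU : IsOpen U) {f : E → N}
    (hf : ContDiffOn ℝ k f U) : IsCk k U f := by
  induction k generalizing E with
  | zero => exact hf.continuousOn
  | succ k ih =>
    have h1 : ContDiffOn ℝ k (fderiv ℝ f) U := hf.fderiv_of_isOpen hU (by norm_cast)
    refine ⟨hf.continuousOn, fun p => fderiv ℝ f p.1 p.2, fun x hx v => ?_,
      ih (hU.prod isOpen_univ) ?_⟩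
    · have h2 : HasFDerivAt f (fderiv ℝ f x) x :=
        ((hf.differentiableOn (by simp)).differentiableAt (hU.mem_nhds hx)).hasFDerivAt
      have h3 := (h2.hasLineDerivAt v).tendsto_slope_zero
      simpa [HasDirDeriv] using h3
    · exact (h1.comp contDiffOn_fst fun p hp => hp.1).clm_apply contDiffOn_snd

/-- The directional derivative `(x, v) ↦ ∂_v f (x)`. -/
def dirD {E : Type*} [AddCommGroup E] [Module ℝ E] (f : E → F) (p : E × E) : F :=
  haveI : Nonempty F := ⟨0⟩
  limUnder (𝓝[≠] (0 : ℝ)) fun t : ℝ => t⁻¹ • (f (p.1 + t • p.2) - f p.1)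

theorem HasDirDeriv.dirD_eq [T2Space F] {E : Type*} [AddCommGroup E] [Module ℝ E]
    [TopologicalSpace E] {f : E → F} {x v : E} {L : F} (h : HasDirDeriv f x v L) :
    dirD f (x, v) = L :=
  h.limUnder_eq

/-- Limits in `F` are unique, so the globally defined `dirD f` can replace any choice of derivative,
whatever `U` is. This is what makes `C^k` a local property in `isCk_of_locally`. -/
theorem isCk_succ_iff [T2Space F] {k : ℕ} {E : Type u} [AddCommGroup E] [Module ℝ E]
    [TopologicalSpace E] [IsTopologicalAddGroup E] [ContinuousSMul ℝ E] {U : Set E}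
    (hU : IsOpen U) {f : E → F} : IsCk (k + 1) U f ↔ ContinuousOn f U ∧
      (∀ x ∈ U, ∀ v, HasDirDeriv f x v (dirD f (x, v))) ∧ IsCk k (U ×ˢ univ) (dirD f) := by
  refine ⟨fun ⟨hc, f', h1, h2⟩ => ⟨hc, fun x hx v => ?_, ?_⟩, fun h => ⟨h.1, _, h.2⟩⟩
  · rw [(h1 x hx v).dirD_eq]
    exact h1 x hx v
  · exact h2.congr (hU.prod isOpen_univ) fun p hp => (h1 p.1 hp.1 p.2).dirD_eq

theorem isCk_of_locally [T2Space F] {k : ℕ} {E : Type u} [AddCommGroup E] [Module ℝ E]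
    [TopologicalSpace E] [IsTopologicalAddGroup E] [ContinuousSMul ℝ E] {U : Set E} {f : E → F}
    (h : ∀ x ∈ U, ∃ W, IsOpen W ∧ x ∈ W ∧ IsCk k W f) : IsCk k U f := by
  have hc : ContinuousOn f U := fun x hx => by
    obtain ⟨W, hW, hxW, hf⟩ := h x hx
    exact (hf.continuousOn.continuousAt (hW.mem_nhds hxW)).continuousWithinAt
  induction k generalizing E with
  | zero => exact hc
  | succ k ih =>
    have h' : ∀ p ∈ U ×ˢ (univ : Set E), ∃ W, IsOpen W ∧ p ∈ W ∧ IsCk k W (dirD f) := by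
      intro p hp
      obtain ⟨W, hW, hxW, hf⟩ := h p.1 hp.1
      exact ⟨W ×ˢ univ, hW.prod isOpen_univ, ⟨hxW, mem_univ _⟩, ((isCk_succ_iff hW).1 hf).2.2⟩
    refine ⟨hc, dirD f, fun x hx v => ?_, ih h' fun p hp => ?_⟩
    · obtain ⟨W, hW, hxW, hf⟩ := h x hx
      exact ((isCk_succ_iff hW).1 hf).2.1 x hxW v
    · obtain ⟨W, hW, hpW, hf⟩ := h' p hp
      exact (hf.continuousOn.continuousAt (hW.mem_nhds hpW)).continuousWithinAt

end Ck

/-! ### Smooth maps are the maps of class `C^k` for all `k` -/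

section SmoothIff

variable {E F : Type*} [AddCommGroup E] [Module ℝ E] [TopologicalSpace E]
  [AddCommGroup F] [Module ℝ F] [TopologicalSpace F]

/-- The iterated directional derivative `∂_{h_j} ⋯ ∂_{h_1} f (x)`. -/
def iterD (f : E → F) : (j : ℕ) → E → (Fin j → E) → F
  | 0, x, _ => f x
  | j + 1, x, h => dirD (fun y => iterD f j y (Fin.init h)) (x, h (Fin.last j))

/-- The continuous linear map `(x, h) ↦ ((x, (h_1, …, h_j)), (h_{j+1}, 0))`. -/
def initLast (E : Type*) [AddCommGroup E] [Module ℝ E] [TopologicalSpace E] (j : ℕ) :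
    E × (Fin (j + 1) → E) →L[ℝ] (E × (Fin j → E)) × (E × (Fin j → E)) where
  toFun p := ((p.1, Fin.init p.2), (p.2 (Fin.last j), 0))
  map_add' p q := by simp [Fin.init_def, Pi.add_def]
  map_smul' c p := by simp [Fin.init_def, Pi.smul_def]
  cont := by
    have h1 : ∀ i : Fin (j + 1), Continuous fun p : E × (Fin (j + 1) → E) => p.2 i := by fun_prop
    exact (continuous_fst.prodMk (continuous_pi fun i : Fin j => h1 i.castSucc)).prodMk
      ((h1 (Fin.last j)).prodMk continuous_const)

/-- The continuous linear map `((x, h), (v, w)) ↦ (x, (h_1, …, h_j, v))`. -/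
def snocFst (E : Type*) [AddCommGroup E] [Module ℝ E] [TopologicalSpace E] (j : ℕ) :
    (E × (Fin j → E)) × (E × (Fin j → E)) →L[ℝ] E × (Fin (j + 1) → E) where
  toFun p := (p.1.1, Fin.snoc p.1.2 p.2.1)
  map_add' p q := by
    refine Prod.ext rfl (funext fun i => ?_)
    refine Fin.lastCases ?_ (fun i => ?_) i <;> simp
  map_smul' c p := by
    refine Prod.ext rfl (funext fun i => ?_)
    refine Fin.lastCases ?_ (fun i => ?_) i <;> simp
  cont := by
    refine (continuous_fst.comp continuous_fst).prodMk ?_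
    exact Continuous.finSnoc (A := fun _ => E) (continuous_snd.comp continuous_fst)
      (continuous_fst.comp continuous_snd)

/-- The continuous linear map replacing the `i`-th entry of `h` by the one of `w`. -/
def updateSnd (E : Type*) [AddCommGroup E] [Module ℝ E] [TopologicalSpace E] (j : ℕ) (i : Fin j) :
    (E × (Fin j → E)) × (E × (Fin j → E)) →L[ℝ] E × (Fin j → E) where
  toFun p := (p.1.1, Function.update p.1.2 i (p.2.2 i))
  map_add' p q := by
    refine Prod.ext rfl (funext fun k => ?_)
    rcases eq_or_ne k i with rfl | hk <;> simp [*]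
  map_smul' c p := by
    refine Prod.ext rfl (funext fun k => ?_)
    rcases eq_or_ne k i with rfl | hk <;> simp [*]
  cont := by
    refine (continuous_fst.comp continuous_fst).prodMk ?_
    refine (continuous_snd.comp continuous_fst).update i ?_
    fun_prop

variable [IsTopologicalAddGroup E] [ContinuousSMul ℝ E] [T2Space F]

/-- Differentiating with `h` frozen is differentiating the uncurried map in the direction `(v, 0)`.
So the iterated derivative of order `j + 1` is the derivative of the uncurried one of order `j`,
composed with the continuous linear map `initLast`; each order costs one degree of
differentiability. -/
theorem isCk_iterD {U : Set E} (hU : IsOpen U) {f : E → F} (hf : ∀ k, IsCk k U f) (j k : ℕ) :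
    IsCk k (U ×ˢ univ) (fun p : E × (Fin j → E) => iterD f j p.1 p.2) ∧
    ∀ x ∈ U, ∀ (h : Fin j → E) (v : E), HasDirDeriv (fun y => iterD f j y h) x v
      (iterD f (j + 1) x (Fin.snoc h v)) := by
  have hd : ∀ j, (∀ k, IsCk k (U ×ˢ univ) (fun p : E × (Fin j → E) => iterD f j p.1 p.2)) →
      ∀ x ∈ U, ∀ (h : Fin j → E) (v : E), HasDirDeriv (fun y => iterD f j y h) x v
      (dirD (fun p : E × (Fin j → E) => iterD f j p.1 p.2) ((x, h), (v, 0))) := by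
    intro j hj x hx h v
    have h1 := ((isCk_succ_iff (hU.prod isOpen_univ)).1 (hj 1)).2.1 (x, h) ⟨hx, mem_univ _⟩ (v, 0)
    refine Tendsto.congr (fun t => ?_) h1
    simp
  have hs : ∀ j, ∀ k, IsCk k (U ×ˢ univ) (fun p : E × (Fin j → E) => iterD f j p.1 p.2) := by
    intro j
    induction j with
    | zero =>
      exact fun k => (hf k).comp_clm (ContinuousLinearMap.fst ℝ E (Fin 0 → E)) fun p hp => hp.1
    | succ j ih =>
      intro k
      have h1 := ((isCk_succ_iff (hU.prod isOpen_univ)).1 (ih (k + 1))).2.2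
      refine (h1.comp_clm (initLast E j)
        (fun p hp => ⟨⟨hp.1, mem_univ _⟩, mem_univ _⟩)).congr (hU.prod isOpen_univ) fun p hp => ?_
      exact (hd j ih p.1 hp.1 (Fin.init p.2) (p.2 (Fin.last j))).dirD_eq
  refine ⟨hs j k, fun x hx h v => ?_⟩
  have h1 := hd j (hs j) x hx h v
  simp only [iterD, Fin.init_snoc, Fin.snoc_last]
  rwa [h1.dirD_eq]

theorem isSmoothOn_of_isCk {U : Set E} (hU : IsOpen U) {f : E → F} (hf : ∀ k, IsCk k U f) :
    IsSmoothOn U f :=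
  ⟨iterD f, fun _ _ _ => rfl, fun j => (isCk_iterD hU hf j 0).1, fun j => (isCk_iterD hU hf j 0).2⟩

variable [IsTopologicalAddGroup F] [ContinuousSMul ℝ F] [LocallyConvexSpace ℝ F]

/-! ### Multilinearity and joint differentiability of the iterated derivatives. -/

section Derivatives

variable {U : Set E} {D : (j : ℕ) → E → (Fin j → E) → F}

/-- In the last entry this is linearity of a directional derivative in its direction. In an earlier
entry the identity for order `j` is differentiated, and the derivative is unique. -/
theorem map_update_add_smul (hU : IsOpen U)
    (hc : ∀ j : ℕ, ContinuousOn (fun p : E × (Fin j → E) => D j p.1 p.2) (U ×ˢ univ))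
    (hD : ∀ j : ℕ, ∀ x ∈ U, ∀ (h : Fin j → E) (v : E),
      HasDirDeriv (fun y => D j y h) x v (D (j + 1) x (Fin.snoc h v)))
    (j : ℕ) (x : E) (hx : x ∈ U) (h : Fin j → E) (i : Fin j) (a b : E) (t : ℝ) :
    D j x (Function.update h i (a + t • b)) =
      D j x (Function.update h i a) + t • D j x (Function.update h i b) := by
  induction j generalizing x with
  | zero => exact i.elim0
  | succ j ih =>
    rw [← Fin.snoc_init_self h]
    refine Fin.lastCases ?_ (fun i => ?_) i
    · simp only [Fin.update_snoc_last]
      have h1 := HasDirDeriv.add_dir hU (f := fun y => D j y (Fin.init h))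
        (f' := fun p : E × E => D (j + 1) p.1 (Fin.snoc (Fin.init h) p.2))
        (fun x hx v => hD j x hx _ v) ?_ hx a (t • b)
      · refine h1.trans ?_
        congr 1
        exact (hD j x hx (Fin.init h) (t • b)).unique ((hD j x hx (Fin.init h) b).const_smul_dir t)
      · refine (hc (j + 1)).comp (f := fun p : E × E =>
          (p.1, (Fin.snoc (Fin.init h) p.2 : Fin (j + 1) → E))) (Continuous.continuousOn ?_)
          fun p hp => ⟨hp.1, mem_univ _⟩
        exact continuous_fst.prodMk (Continuous.finSnoc continuous_const continuous_snd)
    · simp only [← Fin.snoc_update]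
      refine (hD j x hx _ _).unique ?_
      refine ((hD j x hx _ _).add ((hD j x hx _ _).const_smul t)).congr_of_eventuallyEq ?_
      filter_upwards [hU.mem_nhds hx] with y hy
      exact ih y hy _ _

/-- The base point is moved first and then the entries of `h` one after the other; `key` collects
the contributions of the entries in `s`. -/
theorem hasDirDeriv_uncurry (hU : IsOpen U)
    (hc : ∀ j : ℕ, ContinuousOn (fun p : E × (Fin j → E) => D j p.1 p.2) (U ×ˢ univ))
    (hD : ∀ j : ℕ, ∀ x ∈ U, ∀ (h : Fin j → E) (v : E),
      HasDirDeriv (fun y => D j y h) x v (D (j + 1) x (Fin.snoc h v)))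
    (j : ℕ) (x : E) (hx : x ∈ U) (h : Fin j → E) (v : E) (w : Fin j → E) :
    HasDirDeriv (fun p : E × (Fin j → E) => D j p.1 p.2) (x, h) (v, w)
      (D (j + 1) x (Fin.snoc h v) + ∑ i, D j x (Function.update h i (w i))) := by
  have key : ∀ s : Finset (Fin j), Tendsto (fun t : ℝ =>
      t⁻¹ • (D j (x + t • v) (s.piecewise (h + t • w) h) - D j (x + t • v) h)) (𝓝[≠] 0)
      (𝓝 (∑ i ∈ s, D j x (Function.update h i (w i)))) := by
    intro s
    induction s using Finset.induction_on with
    | empty => simp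
    | insert a s ha ih =>
      rw [Finset.sum_insert ha]
      have hcont : Continuous fun t : ℝ => (x + t • v,
          Function.update (s.piecewise (h + t • w) h) a (w a)) := by
        refine Continuous.prodMk (by fun_prop) (Continuous.update ?_ a continuous_const)
        refine continuous_pi fun k => ?_
        by_cases hk : k ∈ s
        · simp only [Finset.piecewise_eq_of_mem _ _ _ hk, Pi.add_apply, Pi.smul_apply]
          fun_prop
        · simp only [Finset.piecewise_eq_of_notMem _ _ _ hk]
          fun_prop
      have h1 := (hcont.tendsto 0).mono_left (nhdsWithin_le_nhds (s := {0}ᶜ))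
      simp only [zero_smul, add_zero, Finset.piecewise_same] at h1
      have h2 : ContinuousAt (fun p : E × (Fin j → E) => D j p.1 p.2)
          (x, Function.update h a (w a)) :=
        (hc j).continuousAt ((hU.prod isOpen_univ).mem_nhds ⟨hx, mem_univ _⟩)
      refine ((h2.tendsto.comp h1).add ih).congr' ?_
      filter_upwards [self_mem_nhdsWithin, (tendsto_line x v).eventually (hU.mem_nhds hx)]
        with t ht htU
      -- By linearity in the entry `a`, its change divided by `t` is exactly a value of `D j`; joint
      -- continuity then suffices for the limit.
      have h3 := map_update_add_smul hU hc hD j (x + t • v) htU (s.piecewise (h + t • w) h) a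
        (h a) (w a) t
      have h4 : Function.update (s.piecewise (h + t • w) h) a (h a) =
          s.piecewise (h + t • w) h := by
        rw [Function.update_eq_self_iff]
        exact (Finset.piecewise_eq_of_notMem _ _ _ ha).symm
      rw [h4] at h3
      rw [Finset.piecewise_insert, Pi.add_apply, Pi.smul_apply, h3, add_sub_right_comm, smul_add,
        inv_smul_smul₀ ht, add_comm]
      rfl
  refine (Tendsto.add (hD j x hx h v) (key Finset.univ)).congr fun t => ?_
  simp only [Finset.piecewise_univ]
  rw [← smul_add]
  simp only [Prod.smul_mk, Prod.mk_add_mk]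
  congr 1
  abel

theorem isCk_uncurry (hU : IsOpen U)
    (hc : ∀ j : ℕ, ContinuousOn (fun p : E × (Fin j → E) => D j p.1 p.2) (U ×ˢ univ))
    (hD : ∀ j : ℕ, ∀ x ∈ U, ∀ (h : Fin j → E) (v : E),
      HasDirDeriv (fun y => D j y h) x v (D (j + 1) x (Fin.snoc h v))) (k j : ℕ) :
    IsCk k (U ×ˢ univ) (fun p : E × (Fin j → E) => D j p.1 p.2) := by
  induction k generalizing j with
  | zero => exact hc j
  | succ k ih =>
    refine ⟨hc j, fun p => D (j + 1) p.1.1 (Fin.snoc p.1.2 p.2.1) +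
      ∑ i, D j p.1.1 (Function.update p.1.2 i (p.2.2 i)), fun p hp q =>
      hasDirDeriv_uncurry hU hc hD j p.1 hp.1 p.2 q.1 q.2, ?_⟩
    refine IsCk.add ?_ (isCk_sum _ fun i _ => ?_)
    · exact (ih (j + 1)).comp_clm (snocFst E j) fun p hp => ⟨hp.1.1, mem_univ _⟩
    · exact (ih j).comp_clm (updateSnd E j i) fun p hp => ⟨hp.1.1, mem_univ _⟩

end Derivatives

theorem isSmoothOn_iff_isCk {U : Set E} (hU : IsOpen U) {f : E → F} :
    IsSmoothOn U f ↔ ∀ k, IsCk k U f := by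
  refine ⟨fun ⟨D, h0, hc, hD⟩ k => ?_, isSmoothOn_of_isCk hU⟩
  have h1 := isCk_uncurry hU hc hD k 0
  refine (h1.comp_clm (ContinuousLinearMap.inl ℝ E (Fin 0 → E))
    (fun x hx => ⟨hx, mem_univ _⟩)).congr hU fun x hx => ?_
  exact (h0 x hx _).symm

end SmoothIff

/-! ### Smoothness at a point -/

section SmoothAt

/-- `f` is smooth in a neighbourhood of `x`. -/
def SmoothAt {E F : Type*} [AddCommGroup E] [Module ℝ E] [TopologicalSpace E]
    [AddCommGroup F] [Module ℝ F] [TopologicalSpace F] (f : E → F) (x : E) : Prop :=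
  ∃ U, IsOpen U ∧ x ∈ U ∧ IsSmoothOn U f

variable {E F F' : Type*} [AddCommGroup E] [Module ℝ E] [TopologicalSpace E]
  [IsTopologicalAddGroup E] [ContinuousSMul ℝ E]
  [AddCommGroup F] [Module ℝ F] [TopologicalSpace F]
  [IsTopologicalAddGroup F] [ContinuousSMul ℝ F] [LocallyConvexSpace ℝ F] [T2Space F]
  [AddCommGroup F'] [Module ℝ F'] [TopologicalSpace F']
  [IsTopologicalAddGroup F'] [ContinuousSMul ℝ F'] [LocallyConvexSpace ℝ F'] [T2Space F']

theorem smoothAt_iff {f : E → F} {x : E} :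
    SmoothAt f x ↔ ∃ U, IsOpen U ∧ x ∈ U ∧ ∀ k, IsCk k U f :=
  exists_congr fun _ => and_congr_right fun hU => and_congr_right fun _ => isSmoothOn_iff_isCk hU

theorem isSmoothOn_iff_smoothAt {U : Set E} (hU : IsOpen U) {f : E → F} :
    IsSmoothOn U f ↔ ∀ x ∈ U, SmoothAt f x := by
  refine ⟨fun h x hx => ⟨U, hU, hx, h⟩, fun h => (isSmoothOn_iff_isCk hU).2 fun k => ?_⟩
  refine isCk_of_locally fun x hx => ?_
  obtain ⟨W, hW, hxW, hf⟩ := smoothAt_iff.1 (h x hx)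
  exact ⟨W, hW, hxW, hf k⟩

theorem SmoothAt.continuousAt {f : E → F} {x : E} (h : SmoothAt f x) : ContinuousAt f x := by
  obtain ⟨U, hU, hx, hf⟩ := smoothAt_iff.1 h
  exact (hf 0).continuousOn.continuousAt (hU.mem_nhds hx)

theorem SmoothAt.congr_of_eventuallyEq {f g : E → F} {x : E} (h : SmoothAt f x)
    (hfg : g =ᶠ[𝓝 x] f) : SmoothAt g x := by
  obtain ⟨U, hU, hx, hf⟩ := smoothAt_iff.1 h
  obtain ⟨W, hW, hWo, hxW⟩ := mem_nhds_iff.1 hfg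
  refine smoothAt_iff.2 ⟨U ∩ W, hU.inter hWo, ⟨hx, hxW⟩, fun k => ?_⟩
  exact ((hf k).mono inter_subset_left).congr (hU.inter hWo) fun y hy => hW hy.2

theorem SmoothAt.comp {g : F → F'} {f : E → F} {x : E} (hg : SmoothAt g (f x))
    (hf : SmoothAt f x) : SmoothAt (fun y => g (f y)) x := by
  obtain ⟨V, hV, hxV, hg⟩ := smoothAt_iff.1 hg
  obtain ⟨U, hU, hx, hf⟩ := smoothAt_iff.1 hf
  have hW : IsOpen (U ∩ f ⁻¹' V) := (hf 0).continuousOn.isOpen_inter_preimage hU hV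
  exact smoothAt_iff.2 ⟨_, hW, ⟨hx, hxV⟩, fun k =>
    (hg k).comp hV ((hf k).mono inter_subset_left) fun y hy => hy.2⟩

theorem SmoothAt.prodMk {f : E → F} {g : E → F'} {x : E} (hf : SmoothAt f x) (hg : SmoothAt g x) :
    SmoothAt (fun y => (f y, g y)) x := by
  obtain ⟨U, hU, hx, hf⟩ := smoothAt_iff.1 hf
  obtain ⟨V, hV, hxV, hg⟩ := smoothAt_iff.1 hg
  exact smoothAt_iff.2 ⟨_, hU.inter hV, ⟨hx, hxV⟩, fun k =>
    ((hf k).mono inter_subset_left).prodMk ((hg k).mono inter_subset_right)⟩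

theorem smoothAt_clm (ℓ : E →L[ℝ] F) (x : E) : SmoothAt ℓ x :=
  smoothAt_iff.2 ⟨univ, isOpen_univ, mem_univ _, fun _ => isCk_clm _ ℓ⟩

theorem smoothAt_const (c : F) (x : E) : SmoothAt (fun _ : E => c) x :=
  smoothAt_iff.2 ⟨univ, isOpen_univ, mem_univ _, fun _ => isCk_const _ c⟩

theorem smoothAt_of_contDiffOn {V N : Type*} [NormedAddCommGroup V] [NormedSpace ℝ V]
    [NormedAddCommGroup N] [NormedSpace ℝ N] {U : Set V} {f : V → N}
    (hf : ∀ k : ℕ, ContDiffOn ℝ k f U) (hU : IsOpen U) {x : V} (hx : x ∈ U) : SmoothAt f x :=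
  smoothAt_iff.2 ⟨U, hU, hx, fun k => isCk_of_contDiffOn hU (hf k)⟩

theorem smoothAt_of_contDiff {V N : Type*} [NormedAddCommGroup V] [NormedSpace ℝ V]
    [NormedAddCommGroup N] [NormedSpace ℝ N] {f : V → N}
    (hf : ∀ k : ℕ, ContDiff ℝ k f) (x : V) : SmoothAt f x :=
  smoothAt_of_contDiffOn (fun k => (hf k).contDiffOn) isOpen_univ (mem_univ x)

end SmoothAt

/-! ### Smooth maps between manifolds -/

section Manifold

attribute [local instance] prodCharted

section

variable (E F : Type*) {M N : Type*} [AddCommGroup E] [Module ℝ E] [TopologicalSpace E]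
  [AddCommGroup F] [Module ℝ F] [TopologicalSpace F] [TopologicalSpace M] [TopologicalSpace N]
  [ChartedSpace E M] [ChartedSpace F N]

/-- `f` is continuous at `x` and smooth near `x` in all charts. -/
def MSmoothAt (f : M → N) (x : M) : Prop :=
  ContinuousAt f x ∧ ∀ e ∈ atlas E M, x ∈ e.source → ∀ e' ∈ atlas F N, f x ∈ e'.source →
    SmoothAt (e' ∘ f ∘ e.symm) (e x)

end

variable {E F E' F' M N P Q : Type*} [AddCommGroup E] [Module ℝ E] [TopologicalSpace E]
  [IsTopologicalAddGroup E] [ContinuousSMul ℝ E] [LocallyConvexSpace ℝ E] [T2Space E]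
  [AddCommGroup F] [Module ℝ F] [TopologicalSpace F]
  [IsTopologicalAddGroup F] [ContinuousSMul ℝ F] [LocallyConvexSpace ℝ F] [T2Space F]
  [AddCommGroup F'] [Module ℝ F'] [TopologicalSpace F']
  [IsTopologicalAddGroup F'] [ContinuousSMul ℝ F'] [LocallyConvexSpace ℝ F'] [T2Space F']
  [TopologicalSpace M] [TopologicalSpace N] [TopologicalSpace P]
  [ChartedSpace E M] [ChartedSpace F N] [ChartedSpace F' P]

theorem isSmoothMapOn_iff {f : M → N} {s : Set M} (hs : IsOpen s) :
    IsSmoothMapOn E F f s ↔ ∀ x ∈ s, MSmoothAt E F f x := by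
  have hopen : ContinuousOn f s → ∀ (e : OpenPartialHomeomorph M E)
      (e' : OpenPartialHomeomorph N F), IsOpen (e.target ∩ e.symm ⁻¹' (s ∩ f ⁻¹' e'.source)) :=
    fun hc e e' => e.isOpen_inter_preimage_symm (hc.isOpen_inter_preimage hs e'.open_source)
  constructor
  · rintro ⟨hc, h⟩ x hx
    refine ⟨hc.continuousAt (hs.mem_nhds hx), fun e he hxe e' he' hxe' => ?_⟩
    refine (isSmoothOn_iff_smoothAt (hopen hc e e')).1 (h e he e' he') _ ⟨e.map_source hxe, ?_⟩
    simp only [mem_preimage, e.left_inv hxe]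
    exact ⟨hx, hxe'⟩
  · intro h
    have hc : ContinuousOn f s := fun x hx => (h x hx).1.continuousWithinAt
    refine ⟨hc, fun e he e' he' => (isSmoothOn_iff_smoothAt (hopen hc e e')).2 fun y hy => ?_⟩
    have h1 := (h _ hy.2.1).2 e he (e.map_target hy.1) e' he' hy.2.2
    rwa [e.right_inv hy.1] at h1

theorem isSmoothMap_iff {f : M → N} : IsSmoothMap E F f ↔ ∀ x, MSmoothAt E F f x := by
  simp [IsSmoothMap, isSmoothMapOn_iff isOpen_univ]

theorem MSmoothAt.continuousAt {f : M → N} {x : M} (h : MSmoothAt E F f x) : ContinuousAt f x :=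
  h.1

theorem eventually_chart {e : OpenPartialHomeomorph M E} {x : M} (hx : x ∈ e.source)
    {p : M → Prop} (hp : ∀ᶠ y in 𝓝 x, p y) : ∀ᶠ y in 𝓝 (e x), p (e.symm y) := by
  have h1 := e.continuousAt_symm (e.map_source hx)
  rw [ContinuousAt, e.left_inv hx] at h1
  exact h1.eventually hp

theorem MSmoothAt.congr_of_eventuallyEq {f g : M → N} {x : M} (h : MSmoothAt E F f x)
    (hfg : g =ᶠ[𝓝 x] f) : MSmoothAt E F g x := by
  refine ⟨h.1.congr hfg.symm, fun e he hx e' he' hx' => ?_⟩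
  rw [hfg.eq_of_nhds] at hx'
  refine (h.2 e he hx e' he' hx').congr_of_eventuallyEq ?_
  filter_upwards [eventually_chart hx hfg] with y hy
  simp [hy]

theorem MSmoothAt.comp {g : N → P} {f : M → N} {x : M} (hg : MSmoothAt F F' g (f x))
    (hf : MSmoothAt E F f x) : MSmoothAt E F' (fun y => g (f y)) x := by
  refine ⟨hg.1.comp hf.1, fun e he hx e'' he'' hx'' => ?_⟩
  set e' := chartAt F (f x) with he'
  have hx' : f x ∈ e'.source := mem_chart_source F (f x)
  have h1 := hf.2 e he hx e' (chart_mem_atlas F _) hx'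
  have h2 := hg.2 e' (chart_mem_atlas F _) hx' e'' he'' hx''
  have h3 : (e' ∘ f ∘ e.symm) (e x) = e' (f x) := by simp [e.left_inv hx]
  rw [← h3] at h2
  refine (h2.comp h1).congr_of_eventuallyEq ?_
  filter_upwards [eventually_chart hx (hf.1.eventually (e'.open_source.mem_nhds hx'))] with y hy
  simp [e'.left_inv hy]

theorem mSmoothAt_const (c : N) (x : M) : MSmoothAt E F (fun _ : M => c) x :=
  ⟨continuousAt_const, fun _ _ _ e' _ _ => smoothAt_const (e' c) _⟩

theorem MSmoothAt.prodMk {f : M → N} {g : M → P} {x : M} (hf : MSmoothAt E F f x)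
    (hg : MSmoothAt E F' g x) : MSmoothAt E (F × F') (fun y => (f y, g y)) x := by
  refine ⟨hf.1.prodMk hg.1, ?_⟩
  rintro e he hx _ ⟨e₁, h₁, e₂, h₂, rfl⟩ hx'
  exact (hf.2 e he hx e₁ h₁ hx'.1).prodMk (hg.2 e he hx e₂ h₂ hx'.2)

variable (E) in
theorem mSmoothAt_id [LCManifold E M] (x : M) : MSmoothAt E E (fun y : M => y) x := by
  refine ⟨continuousAt_id, fun e he hx e' he' hx' => ?_⟩
  refine ⟨(e.symm.trans e').source, (e.symm.trans e').open_source, ?_,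
    LCManifold.smooth_transition e he e' he'⟩
  simp [e.map_source hx, e.left_inv hx, hx']

/-- The chart expressions of the identity are the transition maps. This is used where explicit
transition maps would be awkward: for the circle and for the pullback. -/
theorem lcManifold_of_mSmoothAt_id [T2Space M] (h : ∀ x : M, MSmoothAt E E (fun y : M => y) x) :
    LCManifold E M := by
  refine ⟨inferInstance, fun e he e' he' =>
    (isSmoothOn_iff_smoothAt (e.symm.trans e').open_source).2 fun y hy => ?_⟩
  simp only [OpenPartialHomeomorph.trans_source, OpenPartialHomeomorph.symm_source,
    mem_inter_iff, mem_preimage] at hy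
  have h1 := (h (e.symm y)).2 e he (e.map_target hy.1) e' he' hy.2
  rwa [e.right_inv hy.1] at h1

variable (E F) in
theorem mSmoothAt_fst [LCManifold E M] (x : M × N) :
    MSmoothAt (E × F) E (fun p : M × N => p.1) x := by
  refine ⟨continuousAt_fst, ?_⟩
  rintro _ ⟨e₁, h₁, e₂, h₂, rfl⟩ hx e' he' hx'
  exact ((mSmoothAt_id E x.1).2 e₁ h₁ hx.1 e' he' hx').comp (f := fun p : E × F => p.1)
    (x := (e₁ x.1, e₂ x.2)) (smoothAt_clm (ContinuousLinearMap.fst ℝ E F) _)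

variable (E F) in
theorem mSmoothAt_snd [LCManifold F N] (x : M × N) :
    MSmoothAt (E × F) F (fun p : M × N => p.2) x := by
  refine ⟨continuousAt_snd, ?_⟩
  rintro _ ⟨e₁, h₁, e₂, h₂, rfl⟩ hx e' he' hx'
  exact ((mSmoothAt_id F x.2).2 e₂ h₂ hx.2 e' he' hx').comp (f := fun p : E × F => p.2)
    (x := (e₁ x.1, e₂ x.2)) (smoothAt_clm (ContinuousLinearMap.snd ℝ E F) _)

theorem mSmoothAt_self_iff {f : M → F} {x : M} : MSmoothAt E F f x ↔
    ∀ e ∈ atlas E M, x ∈ e.source → SmoothAt (fun y => f (e.symm y)) (e x) := by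
  refine ⟨fun h e he hx => h.2 e he hx (OpenPartialHomeomorph.refl F) rfl trivial,
    fun h => ⟨?_, ?_⟩⟩
  · have h1 := (h _ (chart_mem_atlas E x) (mem_chart_source E x)).continuousAt
    have hx := mem_chart_source E x
    refine (h1.comp ((chartAt E x).continuousAt hx)).congr ?_
    filter_upwards [(chartAt E x).open_source.mem_nhds hx] with y hy
    simp [(chartAt E x).left_inv hy]
  · rintro e he hx _ rfl _
    exact h e he hx

theorem MSmoothAt.vcomp {f : M → F} {x : M} {B : F → F'} (hB : SmoothAt B (f x))
    (hf : MSmoothAt E F f x) : MSmoothAt E F' (fun y => B (f y)) x := by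
  rw [mSmoothAt_self_iff] at hf ⊢
  intro e he hx
  refine SmoothAt.comp (g := B) ?_ (hf e he hx)
  rwa [e.left_inv hx]

theorem MSmoothAt.vcomp₂ {F'' : Type*} [AddCommGroup F''] [Module ℝ F''] [TopologicalSpace F'']
    [IsTopologicalAddGroup F''] [ContinuousSMul ℝ F''] [LocallyConvexSpace ℝ F''] [T2Space F'']
    {f : M → F} {g : M → F'} {x : M} {B : F × F' → F''} (hB : SmoothAt B (f x, g x))
    (hf : MSmoothAt E F f x) (hg : MSmoothAt E F' g x) :
    MSmoothAt E F'' (fun y => B (f y, g y)) x := by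
  rw [mSmoothAt_self_iff] at hf hg ⊢
  intro e he hx
  refine SmoothAt.comp (g := B) (f := fun y => (f (e.symm y), g (e.symm y))) ?_
    ((hf e he hx).prodMk (hg e he hx))
  rwa [e.left_inv hx]

/-! ### Lie groups -/

section LieGroup

variable {G : Type*} [Group G] [TopologicalSpace G] [ChartedSpace F G] [LCLieGroup F G]

theorem MSmoothAt.mul {f g : M → G} {x : M} (hf : MSmoothAt E F f x) (hg : MSmoothAt E F g x) :
    MSmoothAt E F (fun y => f y * g y) x :=
  MSmoothAt.comp (g := fun p : G × G => p.1 * p.2) (f := fun y => (f y, g y))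
    (isSmoothMap_iff.1 (LCLieGroup.smooth_mul (E := F) (G := G)) (f x, g x)) (hf.prodMk hg)

theorem MSmoothAt.inv {f : M → G} {x : M} (hf : MSmoothAt E F f x) :
    MSmoothAt E F (fun y => (f y)⁻¹) x :=
  (isSmoothMap_iff.1 (LCLieGroup.smooth_inv (E := F) (G := G)) (f x)).comp hf

end LieGroup

end Manifold

/-! ### Smooth maps to normed spaces -/

section Normed

variable {E M : Type*} [AddCommGroup E] [Module ℝ E] [TopologicalSpace E]
  [IsTopologicalAddGroup E] [ContinuousSMul ℝ E] [LocallyConvexSpace ℝ E] [T2Space E]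
  [TopologicalSpace M] [ChartedSpace E M]
  {H : Type*} [NormedAddCommGroup H] [InnerProductSpace ℂ H]
  {H' : Type*} [NormedAddCommGroup H'] [InnerProductSpace ℂ H']

theorem MSmoothAt.smul {f : M → ℂ} {g : M → H} {x : M} (hf : MSmoothAt E ℂ f x)
    (hg : MSmoothAt E H g x) : MSmoothAt E H (fun y => f y • g y) x :=
  MSmoothAt.vcomp₂ (B := fun p : ℂ × H => p.1 • p.2)
    (smoothAt_of_contDiff (fun _ => contDiff_fst.smul contDiff_snd) _) hf hg

theorem MSmoothAt.complex_mul {f g : M → ℂ} {x : M} (hf : MSmoothAt E ℂ f x)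
    (hg : MSmoothAt E ℂ g x) : MSmoothAt E ℂ (fun y => f y * g y) x :=
  MSmoothAt.vcomp₂ (B := fun p : ℂ × ℂ => p.1 * p.2)
    (smoothAt_of_contDiff (fun _ => contDiff_fst.mul contDiff_snd) _) hf hg

theorem MSmoothAt.complex_inv {f : M → ℂ} {x : M} (hf : MSmoothAt E ℂ f x) (h0 : f x ≠ 0) :
    MSmoothAt E ℂ (fun y => (f y)⁻¹) x :=
  MSmoothAt.vcomp (B := fun z : ℂ => z⁻¹) (smoothAt_of_contDiffOn (U := {z | z ≠ 0})
    (fun _ => contDiffOn_id.inv fun _ hz => hz) isOpen_ne h0) hf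

theorem MSmoothAt.const_add {g : M → H} {x : M} (c : H) (hg : MSmoothAt E H g x) :
    MSmoothAt E H (fun y => c + g y) x :=
  MSmoothAt.vcomp (B := fun v : H => c + v)
    (smoothAt_of_contDiff (fun _ => contDiff_const.add contDiff_id) _) hg

theorem MSmoothAt.inner {f g : M → H} {x : M} (hf : MSmoothAt E H f x)
    (hg : MSmoothAt E H g x) : MSmoothAt E ℂ (fun y => inner ℂ (f y) (g y)) x :=
  MSmoothAt.vcomp₂ (B := fun p : H × H => (Inner.inner ℂ p.1 p.2 : ℂ))
    (smoothAt_of_contDiff (fun _ => contDiff_fst.inner ℂ contDiff_snd) _) hf hg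

theorem MSmoothAt.norm_inv {g : M → H} {x : M} (hg : MSmoothAt E H g x) (h0 : g x ≠ 0) :
    MSmoothAt E ℂ (fun y => ((‖g y‖ : ℝ) : ℂ)⁻¹) x := by
  refine MSmoothAt.complex_inv ?_ (by simpa using h0)
  refine MSmoothAt.vcomp (B := fun v : H => ((‖v‖ : ℝ) : ℂ))
    (smoothAt_of_contDiffOn (U := {v | v ≠ 0}) (fun k => ?_) isOpen_ne h0) hg
  exact Complex.ofRealCLM.contDiff.comp_contDiffOn (contDiffOn_id.norm ℂ fun _ hv => hv)

theorem MSmoothAt.clm {g : M → H} {x : M} (hg : MSmoothAt E H g x) (ℓ : H →L[ℝ] H') :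
    MSmoothAt E H' (fun y => ℓ (g y)) x :=
  MSmoothAt.vcomp (smoothAt_clm ℓ _) hg

end Normed

/-! ### The circle -/

section Circle

/-- Stereographic projection and its inverse are given by formulas that are smooth in the ambient
plane, the former off the line `⟪v, x⟫ = 1`, which meets the circle only in the pole `v`. Hence
smoothness of maps to the circle can be tested in `ℂ`. -/
theorem circle_chart (e : OpenPartialHomeomorph Circle CircleModel)
    (he : e ∈ atlas CircleModel Circle) :
    (∃ g : ℂ → CircleModel, (∀ z : Circle, e z = g z) ∧ ∀ z ∈ e.source, SmoothAt g (z : ℂ)) ∧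
    ∀ y, SmoothAt (fun y => (e.symm y : ℂ)) y := by
  have := finrank_real_complex_fact'
  obtain ⟨v, rfl⟩ : ∃ v : Metric.sphere (0 : ℂ) 1, stereographic' (E := ℂ) 1 v = e := by
    obtain ⟨v, hv⟩ := he
    exact ⟨v, hv.symm⟩
  set L := (OrthonormalBasis.fromOrthogonalSpanSingleton (𝕜 := ℝ) 1
    (ne_zero_of_mem_unit_sphere v)).repr with hL
  refine ⟨⟨fun z => L (stereoToFun (v : ℂ) z), fun z => rfl, fun z hz => ?_⟩, fun y => ?_⟩
  · have h1 : IsOpen {x : ℂ | innerSL ℝ (v : ℂ) x ≠ 1} :=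
      isOpen_ne_fun (innerSL ℝ (v : ℂ)).continuous continuous_const
    refine smoothAt_of_contDiffOn
      (fun k => L.contDiff.comp_contDiffOn (contDiffOn_stereoToFun (v := (v : ℂ)))) h1 ?_
    have hz' : (z : ℂ) ≠ v := by
      intro h
      have h2 : z ∈ ({v}ᶜ : Set (Metric.sphere (0 : ℂ) 1)) := by
        rwa [← stereographic'_source (n := 1) v]
      exact h2 (Subtype.ext h)
    have h3 := (inner_lt_one_iff_real_of_norm_eq_one (norm_eq_of_mem_sphere v)
      (Circle.norm_coe z)).2 hz'.symm
    exact h3.ne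
  · exact smoothAt_of_contDiff (f := fun y => stereoInvFunAux (v : ℂ) (L.symm y : ℂ))
      (fun k => contDiff_stereoInvFunAux.comp
        ((ℝ ∙ (v : ℂ))ᗮ.subtypeL.contDiff.comp L.symm.contDiff)) y

variable {E M : Type*} [AddCommGroup E] [Module ℝ E] [TopologicalSpace E]
  [IsTopologicalAddGroup E] [ContinuousSMul ℝ E] [LocallyConvexSpace ℝ E] [T2Space E]
  [TopologicalSpace M] [ChartedSpace E M]

theorem mSmoothAt_circle_coe (z : Circle) : MSmoothAt CircleModel ℂ (fun z : Circle => (z : ℂ)) z :=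
  mSmoothAt_self_iff.2 fun e he _ => (circle_chart e he).2 _

theorem mSmoothAt_circle_iff {f : M → Circle} {x : M} :
    MSmoothAt E CircleModel f x ↔ MSmoothAt E ℂ (fun y => (f y : ℂ)) x := by
  refine ⟨fun h => (mSmoothAt_circle_coe _).comp h, fun h => ⟨?_, ?_⟩⟩
  · exact (⟨rfl⟩ : IsInducing ((↑) : Circle → ℂ)).continuousAt_iff.2 h.1
  · intro e he hx e' he' hx'
    obtain ⟨g, hg, hgs⟩ := (circle_chart e' he').1
    have h1 := (mSmoothAt_self_iff.1 h) e he hx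
    have h2 : SmoothAt (fun y => g (f (e.symm y) : ℂ)) (e x) := by
      refine SmoothAt.comp (g := g) ?_ h1
      rw [e.left_inv hx]
      exact hgs _ hx'
    refine h2.congr_of_eventuallyEq (Eventually.of_forall fun y => ?_)
    simp [hg]

instance lcManifold_circle : LCManifold CircleModel Circle :=
  lcManifold_of_mSmoothAt_id fun z => mSmoothAt_circle_iff.2 (mSmoothAt_circle_coe z)

/-- The phase `z / |z|` of a complex number. -/
def phase (z : ℂ) : Circle := Circle.exp z.arg

theorem coe_phase {z : ℂ} (hz : z ≠ 0) : (phase z : ℂ) = z * ((‖z‖ : ℝ) : ℂ)⁻¹ := by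
  have h : ((‖z‖ : ℝ) : ℂ) ≠ 0 := by simpa using hz
  rw [phase, Circle.coe_exp, eq_mul_inv_iff_mul_eq₀ h, mul_comm]
  exact Complex.norm_mul_exp_arg_mul_I z

theorem MSmoothAt.phase {f : M → ℂ} {x : M} (hf : MSmoothAt E ℂ f x) (h0 : f x ≠ 0) :
    MSmoothAt E CircleModel (fun y => phase (f y)) x := by
  rw [mSmoothAt_circle_iff]
  refine (hf.complex_mul (hf.norm_inv h0)).congr_of_eventuallyEq ?_
  filter_upwards [hf.continuousAt.eventually_ne h0] with y hy
  exact coe_phase hy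

end Circle

/-! ### Intertwiners of linearisations -/

section Intertwiner

attribute [local instance] prodCharted

variable {E : Type v} [AddCommGroup E] [Module ℝ E] [TopologicalSpace E]
  [IsTopologicalAddGroup E] [ContinuousSMul ℝ E] [LocallyConvexSpace ℝ E] [T2Space E]
  {G : Type u} [Group G] [TopologicalSpace G] [ChartedSpace E G]
  {H : Type w} [NormedAddCommGroup H] [InnerProductSpace ℂ H]
  {H' : Type w'} [NormedAddCommGroup H'] [InnerProductSpace ℂ H']

theorem CentralExtension.exists_incl_eq (X : CentralExtension.{u₁, u₂} E G) {x y : X.Total}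
    (h : X.proj x = X.proj y) : ∃ z : Circle, y = x * X.incl z := by
  have h1 : x⁻¹ * y ∈ X.proj.ker := by
    rw [MonoidHom.mem_ker, map_mul, map_inv, h, inv_mul_cancel]
  rw [X.exact] at h1
  obtain ⟨z, hz⟩ := h1
  exact ⟨z, by rw [hz, mul_inv_cancel_left]⟩

theorem phase_coe (z : Circle) : phase (z : ℂ) = z := by
  apply Circle.ext
  rw [coe_phase z.coe_ne_zero, Circle.norm_coe]
  simp

theorem inner_symm_apply (V : H ≃ₗᵢ[ℂ] H) (a b : H) :
    inner ℂ (V.symm a) b = inner ℂ a (V b) := by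
  rw [← V.inner_map_map, V.apply_symm_apply]

theorem inner_inv_apply (V : H ≃ₗᵢ[ℂ] H) (a b : H) :
    inner ℂ (V⁻¹ a) b = inner ℂ a (V b) :=
  inner_symm_apply V a b

/-- Maps between central extensions that intertwine smooth unitary representations are smooth. -/
theorem isSmoothMap_of_intertwines [Nontrivial H]
    {X : CentralExtension.{u₁, u₂} E G} {r : X.Total →* (H ≃ₗᵢ[ℂ] H)} (hr : IsSmoothRep X.Model r)
    {X' : CentralExtension.{u₃, u₄} E G} {r' : X'.Total →* (H' ≃ₗᵢ[ℂ] H')}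
    (hr' : IsSmoothRep X'.Model r') (hincl : ∀ z : Circle, r' (X'.incl z) = scalarU H' z)
    (U : H ≃ₗᵢ[ℂ] H') {Φ : X.Total → X'.Total} (hproj : ∀ x, X'.proj (Φ x) = X.proj x)
    (hΦ : ∀ x ψ, U (r x ψ) = r' (Φ x) (U ψ)) : IsSmoothMap X.Model X'.Model Φ := by
  rw [isSmoothMap_iff]
  intro x₀
  obtain ⟨φ, hφ, -, -, hφs⟩ := X'.locally_trivial (X.proj x₀)
  have hproj₀ := isSmoothMap_iff.1 X.smooth_proj x₀
  -- A local smooth section of `X'`, composed with `X.proj`; near `x₀` the map `Φ` differs from it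
  -- by a circle-valued factor.
  set s : X.Total → X'.Total := fun x => φ.toOpenPartialHomeomorph.symm (X.proj x, 1) with hs
  have hsm : MSmoothAt X.Model X'.Model s x₀ := by
    have h1 := (isSmoothMapOn_iff φ.toOpenPartialHomeomorph.open_target).1 hφs (X.proj x₀, 1)
      (by rw [φ.target_eq]; exact ⟨hφ, mem_univ _⟩)
    exact MSmoothAt.comp (f := fun x => (X.proj x, (1 : Circle))) h1
      (hproj₀.prodMk (mSmoothAt_const 1 x₀))
  have hsp : ∀ᶠ x in 𝓝 x₀, X'.proj (s x) = X.proj x := by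
    filter_upwards [hproj₀.continuousAt.eventually (φ.open_baseSet.mem_nhds hφ)] with x hx
    exact φ.proj_symm_apply (by rw [φ.target_eq]; exact ⟨hx, mem_univ _⟩)
  obtain ⟨ψ, hψ, hψ0⟩ := hr.exists_mem_open (isOpen_compl_singleton (x := (0 : H)))
    (exists_ne (0 : H))
  have hψ0' : r' (s x₀) (U ψ) ≠ 0 := by simpa using hψ0
  obtain ⟨ψ', hψ', hψ'0⟩ := hr'.exists_mem_open
    (U := {a : H' | inner ℂ a (r' (s x₀) (U ψ)) ≠ 0})
    (isOpen_ne_fun (by fun_prop) continuous_const) ⟨_, inner_self_ne_zero.2 hψ0'⟩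
  have hnum : MSmoothAt X.Model ℂ (fun x => inner ℂ ψ' (U (r x ψ))) x₀ :=
    (mSmoothAt_const ψ' x₀).inner ((isSmoothMap_iff.1 hψ x₀).clm
      ((U.toContinuousLinearEquiv : H →L[ℂ] H').restrictScalars ℝ))
  -- `U ψ` is not known to be a smooth vector of `r'`, so the operator is moved to the smooth vector
  -- `ψ'`.
  have hden : MSmoothAt X.Model ℂ (fun x => inner ℂ (r' (s x)⁻¹ ψ') (U ψ)) x₀ :=
    (MSmoothAt.comp (isSmoothMap_iff.1 hψ' _) hsm.inv).inner (mSmoothAt_const (U ψ) x₀)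
  have hden0 : inner ℂ (r' (s x₀)⁻¹ ψ') (U ψ) ≠ 0 := by
    rw [map_inv, inner_inv_apply]
    exact hψ'0
  have key : ∀ x, X'.proj (s x) = X.proj x → inner ℂ (r' (s x)⁻¹ ψ') (U ψ) ≠ 0 →
      ∃ z : Circle, Φ x = s x * X'.incl z ∧
        inner ℂ ψ' (U (r x ψ)) * (inner ℂ (r' (s x)⁻¹ ψ') (U ψ))⁻¹ = (z : ℂ) := by
    intro x hx h0
    obtain ⟨z, hz⟩ := X'.exists_incl_eq (hx.trans (hproj x).symm)
    refine ⟨z, hz, ?_⟩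
    rw [← div_eq_mul_inv, div_eq_iff h0, hΦ, hz, map_mul, hincl, map_inv, inner_inv_apply]
    change inner ℂ ψ' (r' (s x) ((z : ℂ) • U ψ)) = _
    rw [map_smul, inner_smul_right]
  -- Near `x₀` the quotient already has modulus one; `phase` only regards it as an element of the
  -- circle.
  have hc : MSmoothAt X.Model CircleModel
      (fun x => phase (inner ℂ ψ' (U (r x ψ)) * (inner ℂ (r' (s x)⁻¹ ψ') (U ψ))⁻¹)) x₀ := by
    refine (hnum.complex_mul (hden.complex_inv hden0)).phase ?_
    obtain ⟨z, -, hz⟩ := key x₀ hsp.self_of_nhds hden0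
    rw [hz]
    exact z.coe_ne_zero
  refine (hsm.mul (MSmoothAt.comp (isSmoothMap_iff.1 X'.smooth_incl _) hc)).congr_of_eventuallyEq ?_
  filter_upwards [hsp, hden.continuousAt.eventually_ne hden0] with x hx hx0
  obtain ⟨z, hz, hz'⟩ := key x hx hx0
  rw [hz', phase_coe, hz]

/-- Any `y` above the same element of `G` acts by the required operator up to a scalar in the
circle, and multiplying `y` by that scalar corrects it. -/
theorem CentralExtension.Linearizes.exists_intertwined
    {X : CentralExtension.{u₁, u₂} E G} {r : X.Total →* (H ≃ₗᵢ[ℂ] H)} {ρ : G →* PU H}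
    (hX : X.Linearizes r ρ)
    {X' : CentralExtension.{u₃, u₄} E G} {r' : X'.Total →* (H' ≃ₗᵢ[ℂ] H')} {ρ' : G →* PU H'}
    (hX' : X'.Linearizes r' ρ') {U : H ≃ₗᵢ[ℂ] H'} (hU : ∀ g, PU.conj U (ρ g) = ρ' g)
    (x : X.Total) : ∃ y : X'.Total, X'.proj y = X.proj x ∧ r' y = conjU U (r x) := by
  obtain ⟨y, hy⟩ := X'.proj_surjective (X.proj x)
  have h1 : ((r' y : H' ≃ₗᵢ[ℂ] H') : PU H') = (conjU U (r x) : H' ≃ₗᵢ[ℂ] H') := by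
    rw [← hX'.induces, hy, ← hU, hX.induces]
    rfl
  obtain ⟨z, hz⟩ := QuotientGroup.eq.1 h1
  refine ⟨y * X'.incl z, ?_, ?_⟩
  · have : X'.incl z ∈ X'.proj.ker := by rw [X'.exact]; exact ⟨z, rfl⟩
    rw [map_mul, MonoidHom.mem_ker.1 this, mul_one, hy]
  · rw [map_mul, hX'.map_incl, hz, mul_inv_cancel_left]

theorem scalarU_injective [Nontrivial H] : Function.Injective (scalarU H) := by
  intro z z' h
  obtain ⟨ψ, hψ⟩ := exists_ne (0 : H)
  have h1 := DFunLike.congr_fun h ψ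
  exact Circle.ext (smul_left_injective ℂ hψ h1)

/-- The two points differ by some `z` in the circle, and `z • 1 = 1` forces `z = 1` on a nonzero
space. All identities required of `Φ` reduce to this uniqueness. -/
theorem CentralExtension.Linearizes.eq_of_proj_eq [Nontrivial H]
    {X : CentralExtension.{u₁, u₂} E G} {r : X.Total →* (H ≃ₗᵢ[ℂ] H)} {ρ : G →* PU H}
    (hX : X.Linearizes r ρ) {x y : X.Total} (h : X.proj x = X.proj y) (hr : r x = r y) : x = y := by
  obtain ⟨z, rfl⟩ := X.exists_incl_eq h
  rw [map_mul, left_eq_mul, hX.map_incl, ← map_one (scalarU H)] at hr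
  rw [scalarU_injective hr, map_one, mul_one]

theorem projUnitarilyEquivalent_iff [Nontrivial H]
    {X : CentralExtension.{u₁, u₂} E G} {r : X.Total →* (H ≃ₗᵢ[ℂ] H)} {ρ : G →* PU H}
    (hX : X.Linearizes r ρ)
    {X' : CentralExtension.{u₃, u₄} E G} {r' : X'.Total →* (H' ≃ₗᵢ[ℂ] H')} {ρ' : G →* PU H'}
    (hX' : X'.Linearizes r' ρ') : ProjUnitarilyEquivalent ρ ρ' ↔
      ∃ (U : H ≃ₗᵢ[ℂ] H') (Φ : X.Iso X'),
        ∀ (x : X.Total) (ψ : H), U (r x ψ) = r' (Φ.toMulEquiv x) (U ψ) := by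
  constructor
  · rintro ⟨U, hU⟩
    have : Nontrivial H' := U.symm.toEquiv.nontrivial
    have hU' : ∀ g, PU.conj U.symm (ρ' g) = ρ g := by
      intro g
      rw [← hU]
      induction ρ g using QuotientGroup.induction_on with
      | H V =>
        refine congrArg (QuotientGroup.mk (s := scalarSubgroup H)) ?_
        ext ψ
        simp
    choose Φ hΦ hΦr using hX.exists_intertwined hX' hU
    choose Ψ hΨ hΨr using hX'.exists_intertwined hX hU'
    refine ⟨U, ⟨⟨⟨Φ, Ψ, fun x => ?_, fun y => ?_⟩, fun x y => ?_⟩, ?_, ?_, hΦ, fun z => ?_⟩,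
      fun x ψ => ?_⟩
    · refine hX.eq_of_proj_eq (by rw [hΨ, hΦ]) ?_
      ext ψ
      simp [hΨr, hΦr]
    · refine hX'.eq_of_proj_eq (by rw [hΦ, hΨ]) ?_
      ext ψ
      simp [hΨr, hΦr]
    · refine hX'.eq_of_proj_eq (by simp [hΦ]) ?_
      simp only [hΦr, map_mul]
    · exact isSmoothMap_of_intertwines hX.smooth hX'.smooth hX'.map_incl U hΦ
        fun x ψ => by simp [hΦr]
    · exact isSmoothMap_of_intertwines hX'.smooth hX.smooth hX.map_incl U.symm hΨ
        fun x ψ => by simp [hΨr]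
    · refine hX'.eq_of_proj_eq ?_ ?_
      · have h1 : X.incl z ∈ X.proj.ker := by rw [X.exact]; exact ⟨z, rfl⟩
        have h2 : X'.incl z ∈ X'.proj.ker := by rw [X'.exact]; exact ⟨z, rfl⟩
        exact (hΦ _).trans ((MonoidHom.mem_ker.1 h1).trans (MonoidHom.mem_ker.1 h2).symm)
      · refine (hΦr _).trans ?_
        rw [hX.map_incl, hX'.map_incl]
        ext ψ
        simp
    · change U (r x ψ) = r' (Φ x) (U ψ)
      simp [hΦr]
  · rintro ⟨U, Φ, h⟩
    refine ⟨U, fun g => ?_⟩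
    obtain ⟨x, rfl⟩ := X.proj_surjective g
    rw [hX.induces, ← Φ.proj_comp, hX'.induces]
    refine congrArg (QuotientGroup.mk (s := scalarSubgroup H')) ?_
    ext ψ
    simp [h]

end Intertwiner

/-! ### The projective space -/

section ProjectiveSpace

variable {H : Type w} [NormedAddCommGroup H] [InnerProductSpace ℂ H]

theorem isOpen_affineDomain (χ : H) : IsOpen (affineDomain χ) := by
  rw [isOpen_coinduced]
  have h1 : (Projectivization.mk' ℂ : {v : H // v ≠ 0} → ℙ ℂ H) ⁻¹' affineDomain χ =
      {v : {v : H // v ≠ 0} | inner ℂ χ (v : H) ≠ 0} := by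
    ext v
    exact mem_affineDomain_mk χ v v.2
  rw [h1]
  exact isOpen_ne_fun (by fun_prop) continuous_const

/-- The projection to rays is an open map: the saturation of `A` is the union of its multiples by
nonzero scalars. -/
theorem isOpen_setOf_exists_mk {A : Set H} (hA : IsOpen A) :
    IsOpen {p : ℙ ℂ H | ∃ (v : H) (hv : v ≠ 0), v ∈ A ∧ Projectivization.mk ℂ v hv = p} := by
  rw [isOpen_coinduced]
  have h1 : (Projectivization.mk' ℂ : {v : H // v ≠ 0} → ℙ ℂ H) ⁻¹'
      {p : ℙ ℂ H | ∃ (v : H) (hv : v ≠ 0), v ∈ A ∧ Projectivization.mk ℂ v hv = p} =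
      ⋃ a : ℂˣ, {v : {v : H // v ≠ 0} | a • (v : H) ∈ A} := by
    ext v
    simp only [mem_preimage, mem_ofPred_eq, mem_iUnion]
    constructor
    · rintro ⟨u, hu, huA, h⟩
      obtain ⟨a, ha⟩ := (Projectivization.mk_eq_mk_iff ℂ u v hu v.2).1 h
      exact ⟨a, by rwa [ha]⟩
    · rintro ⟨a, ha⟩
      have ha0 : a • (v : H) ≠ 0 := (smul_ne_zero_iff_ne a).2 v.2
      exact ⟨a • (v : H), ha0, ha, (Projectivization.mk_eq_mk_iff ℂ _ (v : H) ha0 v.2).2 ⟨a, rfl⟩⟩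
  rw [h1]
  refine isOpen_iUnion fun a => hA.preimage ?_
  exact continuous_subtype_val.const_smul a

theorem act_mk {a : PU H} {V : H ≃ₗᵢ[ℂ] H} (h : a = (V : PU H)) (φ : H) (hφ : φ ≠ 0) :
    a.act (Projectivization.mk ℂ φ hφ) = Projectivization.mk ℂ (V φ) (by simpa using hφ) := by
  subst h
  rfl

/-- The multiple of `φ` on the right has the same inner product with `χ` as `χ` itself, so it is `χ`
plus an orthogonal vector, and `affineChart_add` applies. -/
theorem add_affineChart_mk (χ φ : H) (hφ : φ ≠ 0) (h : inner ℂ χ φ ≠ 0) :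
    χ + (affineChart χ (Projectivization.mk ℂ φ hφ) : H) = (inner ℂ χ χ / inner ℂ χ φ) • φ := by
  have hχ : χ ≠ 0 := by
    rintro rfl
    simp at h
  have hχ' : inner ℂ χ χ ≠ 0 := inner_self_ne_zero.2 hχ
  set c := inner ℂ χ χ / inner ℂ χ φ with hc
  have hc0 : c ≠ 0 := div_ne_zero hχ' h
  have hu : c • φ - χ ∈ (Submodule.span ℂ {χ})ᗮ := by
    rw [Submodule.mem_orthogonal_singleton_iff_inner_right, inner_sub_right, inner_smul_right, hc,
      div_mul_cancel₀ _ h, sub_self]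
  have h1 : χ + ((⟨c • φ - χ, hu⟩ : (Submodule.span ℂ {χ})ᗮ) : H) = c • φ := by simp
  have h0 : χ + ((⟨c • φ - χ, hu⟩ : (Submodule.span ℂ {χ})ᗮ) : H) ≠ 0 := by
    rw [h1]
    exact smul_ne_zero hc0 hφ
  have h2 := (affineChart_add χ hχ ⟨c • φ - χ, hu⟩ h0).2
  have h3 : Projectivization.mk ℂ (χ + ((⟨c • φ - χ, hu⟩ : (Submodule.span ℂ {χ})ᗮ) : H)) h0 =
      Projectivization.mk ℂ φ hφ :=
    (Projectivization.mk_eq_mk_iff' ℂ _ _ _ _).2 ⟨c, h1.symm⟩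
  rw [h3] at h2
  rw [h2, h1]

theorem phase_mul (z : Circle) {a : ℂ} (ha : a ≠ 0) : phase ((z : ℂ) * a) = z * phase a := by
  apply Circle.ext
  rw [coe_phase (mul_ne_zero z.coe_ne_zero ha), Circle.coe_mul, coe_phase ha, norm_mul,
    Circle.norm_coe, one_mul, mul_assoc]

theorem continuousAt_phase {a : ℂ} (ha : a ≠ 0) : ContinuousAt phase a :=
  (MSmoothAt.phase (E := ℂ) (M := ℂ) (f := fun z => z)
    (mSmoothAt_self_iff.2 fun _ he _ => by
      obtain rfl := he
      exact smoothAt_clm (ContinuousLinearMap.id ℝ ℂ) _) ha).continuousAt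

end ProjectiveSpace

/-! ### The pullback of the unitary group -/

section Pullback

attribute [local instance] prodCharted

variable {E : Type v} [AddCommGroup E] [Module ℝ E] [TopologicalSpace E]
  {G : Type u} [Group G] [TopologicalSpace G] [ChartedSpace E G]
  {H : Type w} [NormedAddCommGroup H] [InnerProductSpace ℂ H]

/-- A vector generating a ray with smooth orbit map. -/
structure SmoothRay (E : Type v) [AddCommGroup E] [Module ℝ E] [TopologicalSpace E]
    {G : Type u} [Group G] [TopologicalSpace G] [ChartedSpace E G]
    {H : Type w} [NormedAddCommGroup H] [InnerProductSpace ℂ H] (ρ : G →* PU H) where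
  /-- the vector -/
  vec : H
  ne_zero : vec ≠ 0
  smooth : IsSmoothToRays E fun g => (ρ g).act (Projectivization.mk ℂ vec ne_zero)

variable {ρ : G →* PU H}

/-- Density of rays gives density of vectors, since an open set of vectors spans an open set of
rays; avoiding a hyperplane keeps an open set nonempty. -/
theorem dense_smoothRay (hρ : IsSmoothProjRep E ρ) {ψ : H} (hψ : ψ ≠ 0) :
    Dense {χ : H | ∃ c : SmoothRay E ρ, c.vec = χ ∧ inner ℂ χ ψ ≠ 0} := by
  rw [dense_iff_inter_open]
  rintro A hA ⟨a, ha⟩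
  have hA' : IsOpen (A ∩ {χ : H | inner ℂ χ ψ ≠ 0}) :=
    hA.inter (isOpen_ne_fun (by fun_prop) continuous_const)
  obtain ⟨b, hbA, hb⟩ : (A ∩ {χ : H | inner ℂ χ ψ ≠ 0}).Nonempty := by
    by_cases h : inner ℂ a ψ = 0
    -- A vector orthogonal to `ψ` is pushed off the hyperplane by a small multiple of `ψ`.
    · have h1 : ∀ᶠ t : ℝ in 𝓝[≠] 0, a + t • ψ ∈ A :=
        (tendsto_line a ψ).eventually (hA.mem_nhds ha)
      obtain ⟨t, ht, ht0⟩ := (h1.and self_mem_nhdsWithin).exists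
      refine ⟨_, ht, ?_⟩
      have h2 : t • ψ = (t : ℂ) • ψ := (Complex.coe_smul t ψ).symm
      rw [mem_ofPred_eq, h2, inner_add_left, h, zero_add, inner_smul_left]
      exact mul_ne_zero (by simpa using ht0) (inner_self_ne_zero.2 hψ)
    · exact ⟨a, ha, h⟩
  have hb0 : b ≠ 0 := by
    rintro rfl
    simp at hb
  obtain ⟨p, hp, χ, hχ0, hχ, rfl⟩ :=
    hρ.exists_mem_open (isOpen_setOf_exists_mk hA') ⟨_, b, hb0, ⟨hbA, hb⟩, rfl⟩
  exact ⟨χ, hχ.1, ⟨χ, hχ0, hp⟩, rfl, hχ.2⟩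

namespace SmoothRay

/-- The set of all `g` such that the ray of `v`, moved by `g`, is not orthogonal to `χ`. -/
def dom (v : SmoothRay E ρ) (χ : H) : Set G :=
  {g | (ρ g).act (Projectivization.mk ℂ v.vec v.ne_zero) ∈ affineDomain χ}

/-- The vector in the ray of `v` moved by `g` whose component parallel to `χ` is `χ`. -/
def repr (v : SmoothRay E ρ) (χ : H) (g : G) : H :=
  χ + (affineChart χ ((ρ g).act (Projectivization.mk ℂ v.vec v.ne_zero)) : H)

/-- The vector in the ray of `v` moved by `g` that has the same norm as `v` and positive
inner product with `χ`. -/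
def sec (v : SmoothRay E ρ) (χ : H) (g : G) : H :=
  ((‖v.vec‖ : ℂ) * ((‖v.repr χ g‖ : ℝ) : ℂ)⁻¹) • v.repr χ g

variable (v : SmoothRay E ρ)

theorem isOpen_dom (χ : H) : IsOpen (v.dom χ) :=
  (isOpen_affineDomain χ).preimage v.smooth.1

theorem mem_dom {χ : H} {g : G} {V : H ≃ₗᵢ[ℂ] H} (h : ρ g = (V : PU H)) :
    g ∈ v.dom χ ↔ inner ℂ χ (V v.vec) ≠ 0 := by
  rw [dom, mem_ofPred_eq, act_mk h, mem_affineDomain_mk]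

theorem repr_eq {χ : H} {g : G} {V : H ≃ₗᵢ[ℂ] H} (h : ρ g = (V : PU H))
    (h0 : inner ℂ χ (V v.vec) ≠ 0) :
    v.repr χ g = (inner ℂ χ χ / inner ℂ χ (V v.vec)) • V v.vec := by
  rw [repr, act_mk h, add_affineChart_mk _ _ _ h0]

theorem repr_ne_zero {χ : H} {g : G} (hg : g ∈ v.dom χ) : v.repr χ g ≠ 0 := by
  obtain ⟨V, hV⟩ := QuotientGroup.mk_surjective (ρ g)
  have h0 := (v.mem_dom hV.symm).1 hg
  rw [v.repr_eq hV.symm h0]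
  have hχ : χ ≠ 0 := by
    rintro rfl
    simp at h0
  exact smul_ne_zero (div_ne_zero (inner_self_ne_zero.2 hχ) h0) (by simpa using v.ne_zero)

/-- Both vectors lie in one ray and have equal norm, so they differ by a phase; since `v.sec χ g`
pairs positively with `χ`, that phase is the one of `⟪χ, V v⟫`. -/
theorem phase_smul_sec {χ : H} {g : G} {V : H ≃ₗᵢ[ℂ] H} (h : ρ g = (V : PU H))
    (h0 : inner ℂ χ (V v.vec) ≠ 0) :
    (phase (inner ℂ χ (V v.vec)) : ℂ) • v.sec χ g = V v.vec := by
  have hχ : χ ≠ 0 := by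
    rintro rfl
    simp at h0
  have hχ1 : ((‖χ‖ : ℝ) : ℂ) ≠ 0 := by simpa using hχ
  have hv1 : ((‖v.vec‖ : ℝ) : ℂ) ≠ 0 := by simpa using v.ne_zero
  rw [coe_phase h0, sec, v.repr_eq h h0, smul_smul, smul_smul, norm_smul, norm_div,
    V.norm_map, inner_self_eq_norm_sq_to_K]
  set a := inner ℂ χ (V v.vec)
  have ha : ((‖a‖ : ℝ) : ℂ) ≠ 0 := by simpa using h0
  convert one_smul ℂ (V v.vec)
  simp only [norm_pow, Complex.coe_algebraMap, Complex.norm_real, norm_norm, Complex.ofReal_mul,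
    Complex.ofReal_div, Complex.ofReal_pow]
  field_simp

variable [IsTopologicalAddGroup E] [ContinuousSMul ℝ E] [LocallyConvexSpace ℝ E] [T2Space E]

theorem mSmoothAt_repr {χ : H} {g : G} (hg : g ∈ v.dom χ) : MSmoothAt E H (v.repr χ) g := by
  have hχ : χ ≠ 0 := by
    rintro rfl
    simp [dom, affineDomain] at hg
  refine MSmoothAt.const_add χ ?_
  rw [mSmoothAt_self_iff]
  intro e he hge
  have h1 : IsOpen (e.target ∩ e.symm ⁻¹' (v.dom χ)) :=
    e.isOpen_inter_preimage_symm (v.isOpen_dom χ)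
  have h2 := (isSmoothOn_iff_smoothAt h1).1 (v.smooth.2 e he χ hχ) (e g)
    ⟨e.map_source hge, by rwa [mem_preimage, e.left_inv hge]⟩
  exact SmoothAt.comp
    (smoothAt_clm (((Submodule.span ℂ {χ})ᗮ.subtypeL).restrictScalars ℝ) _) h2

theorem mSmoothAt_sec {χ : H} {g : G} (hg : g ∈ v.dom χ) : MSmoothAt E H (v.sec χ) g :=
  ((mSmoothAt_const _ g).complex_mul ((v.mSmoothAt_repr hg).norm_inv (v.repr_ne_zero hg))).smul
    (v.mSmoothAt_repr hg)

end SmoothRay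

end Pullback

/-! ### The pullback group: topology, trivializations and manifold structure. -/

section Pullback

attribute [local instance] prodCharted

variable {E : Type v} [AddCommGroup E] [Module ℝ E] [TopologicalSpace E]
  {G : Type u} [Group G] [TopologicalSpace G] [ChartedSpace E G]
  {H : Type w} [NormedAddCommGroup H] [InnerProductSpace ℂ H] {ρ : G →* PU H}

/-- The group of all pairs `(g, V)`, where `V` is a unitary operator that represents `ρ g`. It
carries the topology of the pullback of the sphere of radius `‖v‖`, a circle bundle over the
projective space, along the orbit map of the ray of `v`. -/
def Pullback (_v : SmoothRay E ρ) : Type (max u w) :=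
  MonoidHom.eqLocus (ρ.comp (MonoidHom.fst G (H ≃ₗᵢ[ℂ] H)))
    ((QuotientGroup.mk' (scalarSubgroup H)).comp (MonoidHom.snd G (H ≃ₗᵢ[ℂ] H)))

namespace Pullback

variable {v : SmoothRay E ρ}

instance : Group (Pullback v) :=
  inferInstanceAs (Group (MonoidHom.eqLocus (ρ.comp (MonoidHom.fst G (H ≃ₗᵢ[ℂ] H)))
    ((QuotientGroup.mk' (scalarSubgroup H)).comp (MonoidHom.snd G (H ≃ₗᵢ[ℂ] H)))))

variable (v) in
/-- The projection `(g, V) ↦ g`. -/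
def proj : Pullback v →* G := (MonoidHom.fst G (H ≃ₗᵢ[ℂ] H)).comp (Subgroup.subtype _)

variable (v) in
/-- The representation `(g, V) ↦ V`. -/
def op : Pullback v →* (H ≃ₗᵢ[ℂ] H) := (MonoidHom.snd G (H ≃ₗᵢ[ℂ] H)).comp (Subgroup.subtype _)

theorem induces (x : Pullback v) : ρ (proj v x) = (op v x : PU H) := x.2

theorem exists_of_eq {g : G} {V : H ≃ₗᵢ[ℂ] H} (h : ρ g = (V : PU H)) :
    ∃ x : Pullback v, proj v x = g ∧ op v x = V :=
  ⟨(⟨(g, V), h⟩ : MonoidHom.eqLocus (ρ.comp (MonoidHom.fst G (H ≃ₗᵢ[ℂ] H)))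
    ((QuotientGroup.mk' (scalarSubgroup H)).comp (MonoidHom.snd G (H ≃ₗᵢ[ℂ] H)))), rfl, rfl⟩

theorem ext {x y : Pullback v} (h : proj v x = proj v y) (h' : op v x = op v y) : x = y :=
  Subtype.ext (Prod.ext h h')

variable (v) in
/-- The inclusion `z ↦ (1, z • 1)` of the circle group. -/
def incl : Circle →* Pullback v :=
  ((MonoidHom.inr G (H ≃ₗᵢ[ℂ] H)).comp (scalarU H)).codRestrict _ fun z => by
    change ρ 1 = ((scalarU H z : H ≃ₗᵢ[ℂ] H) : PU H)
    rw [map_one]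
    exact ((QuotientGroup.eq_one_iff (N := scalarSubgroup H) (scalarU H z)).2 ⟨z, rfl⟩).symm

@[simp]
theorem proj_incl (z : Circle) : proj v (incl v z) = 1 := rfl

@[simp]
theorem op_incl (z : Circle) : op v (incl v z) = scalarU H z := rfl

theorem op_mul_incl (x : Pullback v) (z : Circle) (φ : H) :
    op v (x * incl v z) φ = (z : ℂ) • op v x φ := by
  rw [map_mul, op_incl]
  exact map_smul (op v x) (z : ℂ) φ

variable (v) in
theorem proj_surjective : Function.Surjective (proj v) := fun g => by
  obtain ⟨V, hV⟩ := QuotientGroup.mk_surjective (ρ g)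
  obtain ⟨x, hx, -⟩ := exists_of_eq (v := v) hV.symm
  exact ⟨x, hx⟩

theorem exists_incl_eq {x y : Pullback v} (h : proj v x = proj v y) :
    ∃ z : Circle, y = x * incl v z := by
  have h1 : ((op v x : H ≃ₗᵢ[ℂ] H) : PU H) = (op v y : H ≃ₗᵢ[ℂ] H) := by
    rw [← induces, ← induces, h]
  obtain ⟨z, hz⟩ := QuotientGroup.eq.1 h1
  exact ⟨z, ext (by simp [h]) (by rw [map_mul, op_incl, hz, mul_inv_cancel_left])⟩

instance : TopologicalSpace (Pullback v) :=
  TopologicalSpace.induced (fun x => (proj v x, op v x v.vec)) inferInstance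

theorem isInducing : IsInducing fun x : Pullback v => (proj v x, op v x v.vec) := ⟨rfl⟩

theorem continuous_proj : Continuous (proj v) :=
  (isInducing (v := v)).continuous.fst

theorem continuous_op_vec : Continuous fun x : Pullback v => op v x v.vec :=
  (isInducing (v := v)).continuous.snd

theorem op_vec_ne_zero (x : Pullback v) : op v x v.vec ≠ 0 := by simpa using v.ne_zero

/-- Operators above the same `g` differ by a scalar, which a single nonzero vector detects. -/
theorem injective : Function.Injective fun x : Pullback v => (proj v x, op v x v.vec) := by
  intro x y h
  have h' : proj v x = proj v y := (Prod.ext_iff.1 h).1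
  obtain ⟨z, rfl⟩ := exists_incl_eq h'
  have h1 : op v x v.vec = op v (x * incl v z) v.vec := (Prod.ext_iff.1 h).2
  rw [op_mul_incl] at h1
  have h2 : (z : ℂ) = 1 :=
    smul_left_injective ℂ (op_vec_ne_zero x) (h1.symm.trans (one_smul ℂ _).symm)
  rw [show z = 1 from Circle.ext h2, map_one, mul_one]

variable (v) in
/-- A lift of `g`. -/
def lift (g : G) : Pullback v := (proj_surjective v g).choose

theorem proj_lift (g : G) : proj v (lift v g) = g := (proj_surjective v g).choose_spec

variable (v) in
/-- The lift of `g` with phase `z` relative to `χ`. -/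
def liftPhase (χ : H) (p : G × Circle) : Pullback v :=
  lift v p.1 * incl v (p.2 * (phase (inner ℂ χ (op v (lift v p.1) v.vec)))⁻¹)

theorem proj_liftPhase (χ : H) (p : G × Circle) : proj v (liftPhase v χ p) = p.1 := by
  simp [liftPhase, proj_lift]

theorem mem_dom {χ : H} {x : Pullback v} :
    proj v x ∈ v.dom χ ↔ inner ℂ χ (op v x v.vec) ≠ 0 :=
  v.mem_dom (induces x)

theorem inner_liftPhase {χ : H} {p : G × Circle} (hp : p.1 ∈ v.dom χ) :
    inner ℂ χ (op v (liftPhase v χ p) v.vec) ≠ 0 := by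
  rwa [← mem_dom, proj_liftPhase]

theorem phase_liftPhase {χ : H} {p : G × Circle} (hp : p.1 ∈ v.dom χ) :
    phase (inner ℂ χ (op v (liftPhase v χ p) v.vec)) = p.2 := by
  have h0 : inner ℂ χ (op v (lift v p.1) v.vec) ≠ 0 := by rwa [← mem_dom, proj_lift]
  rw [liftPhase, op_mul_incl, inner_smul_right, phase_mul _ h0, inv_mul_cancel_right]

theorem liftPhase_proj {χ : H} {x : Pullback v} (hx : inner ℂ χ (op v x v.vec) ≠ 0) :
    liftPhase v χ (proj v x, phase (inner ℂ χ (op v x v.vec))) = x := by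
  obtain ⟨z, hz⟩ := exists_incl_eq (proj_lift (proj v x))
  have h0 : inner ℂ χ (op v (lift v (proj v x)) v.vec) ≠ 0 := by
    rw [← mem_dom, proj_lift, mem_dom]
    exact hx
  have h1 : inner ℂ χ (op v x v.vec) = (z : ℂ) * inner ℂ χ (op v (lift v (proj v x)) v.vec) := by
    conv_lhs => rw [hz, op_mul_incl, inner_smul_right]
  rw [liftPhase, h1, phase_mul _ h0, mul_inv_cancel_right]
  exact hz.symm

theorem op_liftPhase {χ : H} {p : G × Circle} (hp : p.1 ∈ v.dom χ) :
    op v (liftPhase v χ p) v.vec = (p.2 : ℂ) • v.sec χ p.1 := by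
  have h1 := v.phase_smul_sec (induces (liftPhase v χ p)) (inner_liftPhase hp)
  rw [phase_liftPhase hp, proj_liftPhase] at h1
  exact h1.symm

variable [IsTopologicalAddGroup E] [ContinuousSMul ℝ E] [LocallyConvexSpace ℝ E] [T2Space E]

variable (v) in
/-- The trivialization of the circle bundle over the set of all `g` such that the ray of `v`,
moved by `g`, is not orthogonal to `χ`. -/
def triv (χ : H) : OpenPartialHomeomorph (Pullback v) (G × Circle) where
  toFun x := (proj v x, phase (inner ℂ χ (op v x v.vec)))
  invFun := liftPhase v χ
  source := proj v ⁻¹' v.dom χ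
  target := v.dom χ ×ˢ univ
  map_source' x hx := ⟨hx, mem_univ _⟩
  map_target' p hp := by
    rw [mem_preimage, proj_liftPhase]
    exact hp.1
  left_inv' x hx := liftPhase_proj (mem_dom.1 hx)
  right_inv' p hp := Prod.ext (proj_liftPhase χ p) (phase_liftPhase hp.1)
  open_source := (v.isOpen_dom χ).preimage continuous_proj
  open_target := (v.isOpen_dom χ).prod isOpen_univ
  continuousOn_toFun := fun x hx => by
    have h1 : Continuous fun x : Pullback v => inner ℂ χ (op v x v.vec) :=
      continuous_const.inner continuous_op_vec
    have h2 : ContinuousAt (fun x : Pullback v => phase (inner ℂ χ (op v x v.vec))) x :=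
      ContinuousAt.comp (g := phase) (continuousAt_phase (mem_dom.1 hx)) h1.continuousAt
    exact (continuous_proj.continuousAt.prodMk h2).continuousWithinAt
  continuousOn_invFun := fun p hp => by
    have h1 : (v.dom χ ×ˢ (univ : Set Circle)) ∈ 𝓝 p :=
      ((v.isOpen_dom χ).prod isOpen_univ).mem_nhds hp
    -- The lifts are chosen with no regard to continuity, but the inducing map sends `liftPhase` to
    -- `(g, z • v.sec χ g)`, where the choice has disappeared.
    refine ContinuousAt.continuousWithinAt (isInducing.continuousAt_iff.2 ?_)
    have h2 : ContinuousAt (fun q : G × Circle => (q.1, (q.2 : ℂ) • v.sec χ q.1)) p := by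
      refine continuousAt_fst.prodMk (ContinuousAt.smul ?_ ?_)
      · exact ContinuousAt.comp (mSmoothAt_circle_coe p.2).continuousAt continuousAt_snd
      · exact ContinuousAt.comp (v.mSmoothAt_sec hp.1).continuousAt continuousAt_fst
    refine h2.congr ?_
    filter_upwards [h1] with q hq
    exact Prod.ext (proj_liftPhase χ q).symm (op_liftPhase hq.1).symm

theorem mem_triv_source {χ : H} {x : Pullback v} :
    x ∈ (triv v χ).source ↔ inner ℂ χ (op v x v.vec) ≠ 0 := mem_dom

theorem mem_triv_op_source (x : Pullback v) : x ∈ (triv v (op v x v.vec)).source :=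
  mem_triv_source.2 (inner_self_ne_zero.2 (op_vec_ne_zero x))

variable (v) in
/-- The trivializations as charts with values in `G × 𝕋`. -/
@[reducible]
def chartedTriv : ChartedSpace (G × Circle) (Pullback v) where
  atlas := range (triv v)
  chartAt x := triv v (op v x v.vec)
  mem_chart_source := mem_triv_op_source
  chart_mem_atlas _ := mem_range_self _

instance : ChartedSpace (E × CircleModel) (Pullback v) :=
  letI := chartedTriv v
  ChartedSpace.comp (E × CircleModel) (G × Circle) (Pullback v)

theorem mem_atlas_iff {e : OpenPartialHomeomorph (Pullback v) (E × CircleModel)} :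
    e ∈ atlas (E × CircleModel) (Pullback v) ↔
      ∃ χ : H, ∃ c ∈ atlas (E × CircleModel) (G × Circle), (triv v χ).trans c = e := by
  constructor
  · rintro ⟨_, ⟨χ, rfl⟩, c, hc, h⟩
    exact ⟨χ, c, hc, h⟩
  · rintro ⟨χ, c, hc, h⟩
    exact ⟨_, ⟨χ, rfl⟩, c, hc, h⟩

/-! ### Tests for smoothness of maps from and to the pullback. -/

section Smooth

variable {F N : Type*} [AddCommGroup F] [Module ℝ F] [TopologicalSpace F]
  [IsTopologicalAddGroup F] [ContinuousSMul ℝ F] [LocallyConvexSpace ℝ F] [T2Space F]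
  [TopologicalSpace N] [ChartedSpace F N]

/-- Every chart of the pullback is some `triv v χ` followed by a chart of `G × 𝕋`, so smoothness is
tested on `G × 𝕋`. -/
theorem mSmoothAt_of_triv_source {f : Pullback v → N} {x : Pullback v}
    (h : ∀ χ, x ∈ (triv v χ).source →
      MSmoothAt (E × CircleModel) F (fun p => f ((triv v χ).symm p)) (triv v χ x)) :
    MSmoothAt (E × CircleModel) F f x := by
  constructor
  · have hx := mem_triv_op_source x
    refine ((h _ hx).continuousAt.comp ((triv v _).continuousAt hx)).congr ?_
    filter_upwards [(triv v _).open_source.mem_nhds hx] with y hy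
    simp [(triv v _).left_inv hy]
  · intro e he hx e' he' hx'
    obtain ⟨χ, c, hc, rfl⟩ := mem_atlas_iff.1 he
    rw [OpenPartialHomeomorph.trans_source] at hx
    refine (h χ hx.1).2 c hc hx.2 e' he' ?_
    simpa only [(triv v χ).left_inv hx.1] using hx'

theorem mSmoothAt_of_triv_target {f : N → Pullback v} {y : N} (hc : ContinuousAt f y)
    (h : ∀ χ, f y ∈ (triv v χ).source →
      MSmoothAt F (E × CircleModel) (fun p => triv v χ (f p)) y) :
    MSmoothAt F (E × CircleModel) f y := by
  refine ⟨hc, fun e he hy e' he' hy' => ?_⟩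
  obtain ⟨χ, c, hcc, rfl⟩ := mem_atlas_iff.1 he'
  rw [OpenPartialHomeomorph.trans_source] at hy'
  exact (h χ hy'.1).2 e he hy c hcc hy'.2

variable [LCManifold E G]

theorem mSmoothAt_smul_sec {χ : H} {p : G × Circle} (hp : p.1 ∈ v.dom χ) :
    MSmoothAt (E × CircleModel) H (fun q : G × Circle => (q.2 : ℂ) • v.sec χ q.1) p :=
  MSmoothAt.smul
    (MSmoothAt.comp (mSmoothAt_circle_coe p.2) (mSmoothAt_snd E CircleModel p))
    (MSmoothAt.comp (v.mSmoothAt_sec hp) (mSmoothAt_fst E CircleModel p))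

theorem mSmoothAt_op_liftPhase {χ : H} {p : G × Circle} (hp : p ∈ (triv v χ).target) :
    MSmoothAt (E × CircleModel) H
      (fun q : G × Circle => op v ((triv v χ).symm q) v.vec) p := by
  refine (mSmoothAt_smul_sec hp.1).congr_of_eventuallyEq ?_
  filter_upwards [(triv v χ).open_target.mem_nhds hp] with q hq
  exact op_liftPhase hq.1

theorem mSmoothAt_proj_liftPhase (χ : H) (p : G × Circle) :
    MSmoothAt (E × CircleModel) E (fun q : G × Circle => proj v ((triv v χ).symm q)) p :=
  (mSmoothAt_fst E CircleModel p).congr_of_eventuallyEq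
    (Eventually.of_forall fun q => proj_liftPhase χ q)

theorem mSmoothAt_op_vec (x : Pullback v) :
    MSmoothAt (E × CircleModel) H (fun y : Pullback v => op v y v.vec) x :=
  mSmoothAt_of_triv_source fun χ hx => mSmoothAt_op_liftPhase ((triv v χ).map_source hx)

theorem mSmoothAt_proj (x : Pullback v) : MSmoothAt (E × CircleModel) E (proj v) x :=
  mSmoothAt_of_triv_source fun χ _ => mSmoothAt_proj_liftPhase χ _

theorem mSmoothAt_triv_symm {χ : H} {p : G × Circle} (hp : p ∈ (triv v χ).target) :
    MSmoothAt (E × CircleModel) (E × CircleModel) (triv v χ).symm p := by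
  refine mSmoothAt_of_triv_target ((triv v χ).continuousAt_symm hp) fun χ' hp' => ?_
  exact (mSmoothAt_proj_liftPhase χ p).prodMk
    (((mSmoothAt_const χ' p).inner (mSmoothAt_op_liftPhase hp)).phase (mem_triv_source.1 hp'))

/-- A map to the pullback is smooth if its composition with the projection is smooth, and also one
of the matrix coefficients that do not vanish. -/
theorem mSmoothAt_of_inner {f : N → Pullback v} {y : N}
    (h : MSmoothAt F E (fun p => proj v (f p)) y) {χ : H}
    (hχ : MSmoothAt F ℂ (fun p => inner ℂ χ (op v (f p) v.vec)) y)
    (h0 : inner ℂ χ (op v (f y) v.vec) ≠ 0) : MSmoothAt F (E × CircleModel) f y := by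
  have h1 : (proj v (f y), phase (inner ℂ χ (op v (f y) v.vec))) ∈ (triv v χ).target :=
    ⟨mem_dom.2 h0, mem_univ _⟩
  refine (MSmoothAt.comp (f := fun p => (proj v (f p), phase (inner ℂ χ (op v (f p) v.vec))))
    (mSmoothAt_triv_symm h1) (h.prodMk (hχ.phase h0))).congr_of_eventuallyEq ?_
  filter_upwards [hχ.continuousAt.eventually_ne h0] with p hp
  exact (liftPhase_proj hp).symm

theorem mSmoothAt_triv {χ : H} {x : Pullback v} (hx : x ∈ (triv v χ).source) :
    MSmoothAt (E × CircleModel) (E × CircleModel) (triv v χ) x :=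
  (mSmoothAt_proj x).prodMk
    (((mSmoothAt_const χ x).inner (mSmoothAt_op_vec x)).phase (mem_triv_source.1 hx))

instance : LCManifold (E × CircleModel) (Pullback v) := by
  have : T2Space G := LCManifold.t2 E
  have : T2Space (Pullback v) := T2Space.of_injective_continuous injective isInducing.continuous
  refine lcManifold_of_mSmoothAt_id fun x => mSmoothAt_of_inner (mSmoothAt_proj x)
    ((mSmoothAt_const (op v x v.vec) x).inner (mSmoothAt_op_vec x))
    (inner_self_ne_zero.2 (op_vec_ne_zero x))

end Smooth

end Pullback

end Pullback

/-! ### Smooth group operations, the central extension and its representation. -/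

section Pullback

attribute [local instance] prodCharted

variable {E : Type v} [AddCommGroup E] [Module ℝ E] [TopologicalSpace E]
  [IsTopologicalAddGroup E] [ContinuousSMul ℝ E] [LocallyConvexSpace ℝ E] [T2Space E]
  {G : Type u} [Group G] [TopologicalSpace G] [ChartedSpace E G] [LCLieGroup E G]
  {H : Type w} [NormedAddCommGroup H] [InnerProductSpace ℂ H] {ρ : G →* PU H}

namespace Pullback

variable {v : SmoothRay E ρ}

/-- The vector `V c` is, up to a constant factor, the orthogonal projection of `V v` to the line
of `V c`, and this projection depends on the ray of `c` only. -/
theorem mSmoothAt_op_of_smoothRay (c : SmoothRay E ρ) (hc : inner ℂ c.vec v.vec ≠ 0)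
    (x : Pullback v) :
    MSmoothAt (E × CircleModel) H (fun y : Pullback v => op v y c.vec) x := by
  set η := op v x c.vec with hη
  have hη0 : inner ℂ η (op v x c.vec) ≠ 0 :=
    inner_self_ne_zero.2 ((map_ne_zero_iff _ (op v x).injective).2 c.ne_zero)
  have hdom : proj v x ∈ c.dom η := (c.mem_dom (induces x)).2 hη0
  have h1 : MSmoothAt (E × CircleModel) H (fun y => c.repr η (proj v y)) x :=
    MSmoothAt.comp (c.mSmoothAt_repr hdom) (mSmoothAt_proj x)
  have h2 := h1.norm_inv (c.repr_ne_zero hdom)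
  -- As `V` is unitary, the projection of `V v` to the line of `V c` is `(⟪c, v⟫ / ‖c‖²) V c`; the
  -- constant factor undoes this coefficient.
  have h3 : MSmoothAt (E × CircleModel) H (fun y : Pullback v =>
      (((‖c.vec‖ : ℂ) ^ 2 / inner ℂ c.vec v.vec) * ((((‖c.repr η (proj v y)‖ : ℝ) : ℂ)⁻¹ *
        ((‖c.repr η (proj v y)‖ : ℝ) : ℂ)⁻¹) *
        inner ℂ (c.repr η (proj v y)) (op v y v.vec))) • c.repr η (proj v y)) x :=
    ((mSmoothAt_const _ x).complex_mul
      ((h2.complex_mul h2).complex_mul (h1.inner (mSmoothAt_op_vec x)))).smul h1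
  refine h3.congr_of_eventuallyEq ?_
  filter_upwards [(mSmoothAt_proj x).continuousAt.eventually ((c.isOpen_dom η).mem_nhds hdom)]
    with y hy
  have hy0 := (c.mem_dom (induces y)).1 hy
  have hr := c.repr_eq (induces y) hy0
  have hr0 := c.repr_ne_zero hy
  set l := inner ℂ η η / inner ℂ η (op v y c.vec)
  have hl : l ≠ 0 := by
    intro h
    rw [hr, h, zero_smul] at hr0
    exact hr0 rfl
  have hl' : ((‖l‖ : ℝ) : ℂ) ≠ 0 := by simpa using hl
  have hc' : ((‖c.vec‖ : ℝ) : ℂ) ≠ 0 := by simpa using c.ne_zero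
  rw [hr, inner_smul_left, (op v y).inner_map_map, norm_smul, (op v y).norm_map, smul_smul]
  symm
  convert one_smul ℂ (op v y c.vec)
  have h4 : (starRingEnd ℂ) l * l = ((‖l‖ : ℝ) : ℂ) ^ 2 := Complex.conj_mul' l
  rw [Complex.ofReal_mul]
  field_simp
  linear_combination h4

/-- The coefficient `⟪c, V⁻¹ v⟫ = ⟪V c, v⟫` is smooth, and density provides a `c` for which it does
not vanish at `x` and `⟪c, v⟫ ≠ 0`. -/
theorem mSmoothAt_inv (hρ : IsSmoothProjRep E ρ) (x : Pullback v) :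
    MSmoothAt (E × CircleModel) (E × CircleModel) (fun y : Pullback v => y⁻¹) x := by
  obtain ⟨χ, ⟨c, rfl, hc⟩, hχ⟩ := (dense_smoothRay hρ v.ne_zero).exists_mem_open
    (U := {a : H | inner ℂ a (op v x⁻¹ v.vec) ≠ 0})
    (isOpen_ne_fun (by fun_prop) continuous_const) ⟨_, inner_self_ne_zero.2 (op_vec_ne_zero x⁻¹)⟩
  refine mSmoothAt_of_inner (v := v) (χ := c.vec) ?_ ?_ hχ
  · exact ((mSmoothAt_proj x).inv).congr_of_eventuallyEq
      (Eventually.of_forall fun y => map_inv (proj v) y)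
  · refine ((mSmoothAt_op_of_smoothRay c hc x).inner
      (mSmoothAt_const v.vec x)).congr_of_eventuallyEq (Eventually.of_forall fun y => ?_)
    change inner ℂ c.vec (op v y⁻¹ v.vec) = inner ℂ (op v y c.vec) v.vec
    rw [← inner_inv_apply, ← map_inv, inv_inv]

/-- The coefficient `⟪c, V W v⟫ = ⟪V⁻¹ c, W v⟫` separates the two factors, so only orbit maps of
single vectors and the smoothness of inversion are needed, not joint smoothness of an action. -/
theorem mSmoothAt_mul (hρ : IsSmoothProjRep E ρ) (p : Pullback v × Pullback v) :
    MSmoothAt ((E × CircleModel) × (E × CircleModel)) (E × CircleModel)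
      (fun q : Pullback v × Pullback v => q.1 * q.2) p := by
  obtain ⟨χ, ⟨c, rfl, hc⟩, hχ⟩ := (dense_smoothRay hρ v.ne_zero).exists_mem_open
    (U := {a : H | inner ℂ a (op v (p.1 * p.2) v.vec) ≠ 0})
    (isOpen_ne_fun (by fun_prop) continuous_const)
    ⟨_, inner_self_ne_zero.2 (op_vec_ne_zero (p.1 * p.2))⟩
  have h1 := mSmoothAt_fst (E × CircleModel) (E × CircleModel) p
  have h2 := mSmoothAt_snd (E × CircleModel) (E × CircleModel) p
  refine mSmoothAt_of_inner (v := v) (χ := c.vec) ?_ ?_ hχ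
  · exact (MSmoothAt.mul (MSmoothAt.comp (mSmoothAt_proj p.1) h1)
      (MSmoothAt.comp (mSmoothAt_proj p.2) h2)).congr_of_eventuallyEq
      (Eventually.of_forall fun q => map_mul (proj v) q.1 q.2)
  · have h3 : MSmoothAt ((E × CircleModel) × (E × CircleModel)) H
        (fun q : Pullback v × Pullback v => op v q.1⁻¹ c.vec) p :=
      MSmoothAt.comp (g := fun y : Pullback v => op v y c.vec)
        (mSmoothAt_op_of_smoothRay c hc p.1⁻¹)
        (MSmoothAt.comp (g := fun y : Pullback v => y⁻¹) (mSmoothAt_inv hρ p.1) h1)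
    refine (h3.inner (MSmoothAt.comp (mSmoothAt_op_vec p.2) h2)).congr_of_eventuallyEq
      (Eventually.of_forall fun q => ?_)
    change inner ℂ c.vec (op v (q.1 * q.2) v.vec) = inner ℂ (op v q.1⁻¹ c.vec) (op v q.2 v.vec)
    rw [map_inv, inner_inv_apply, map_mul]
    rfl

theorem lcLieGroup (hρ : IsSmoothProjRep E ρ) : LCLieGroup (E × CircleModel) (Pullback v) where
  smooth_mul := isSmoothMap_iff.2 (mSmoothAt_mul hρ)
  smooth_inv := isSmoothMap_iff.2 (mSmoothAt_inv hρ)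

theorem isSmoothRep_op (hρ : IsSmoothProjRep E ρ) : IsSmoothRep (E × CircleModel) (op v) := by
  refine (dense_smoothRay hρ v.ne_zero).mono ?_
  rintro _ ⟨c, rfl, hc⟩
  exact isSmoothMap_iff.2 (mSmoothAt_op_of_smoothRay c hc)

theorem mSmoothAt_incl (z : Circle) : MSmoothAt CircleModel (E × CircleModel) (incl v) z := by
  have h1 : ∀ z, inner ℂ v.vec (op v (incl v z) v.vec) = (z : ℂ) * inner ℂ v.vec v.vec :=
    fun z => by rw [op_incl, scalarU_apply, inner_smul_right]
  refine mSmoothAt_of_inner (v := v) (χ := v.vec) (mSmoothAt_const 1 z) ?_ ?_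
  · simp only [h1]
    exact (mSmoothAt_circle_coe z).complex_mul (mSmoothAt_const _ z)
  · rw [h1]
    exact mul_ne_zero z.coe_ne_zero (inner_self_ne_zero.2 v.ne_zero)

variable (v) in
/-- The trivialization `triv v χ` as a trivialization of the bundle `proj v`. -/
def trivialization (χ : H) : Bundle.Trivialization Circle (proj v) where
  toOpenPartialHomeomorph := triv v χ
  baseSet := v.dom χ
  open_baseSet := v.isOpen_dom χ
  source_eq := rfl
  target_eq := rfl
  proj_toFun _ _ := rfl

variable (v) in
/-- The central extension given by the pullback of the unitary group. -/
def extension (hρ : IsSmoothProjRep E ρ) : CentralExtension.{max u w, v} E G :=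
  { Model := E × CircleModel
    Total := Pullback v
    lieGroup := lcLieGroup hρ
    incl := incl v
    proj := proj v
    smooth_incl := isSmoothMap_iff.2 mSmoothAt_incl
    smooth_proj := isSmoothMap_iff.2 mSmoothAt_proj
    incl_injective := fun z z' h => by
      have : Nontrivial H := ⟨v.vec, 0, v.ne_zero⟩
      exact scalarU_injective (congrArg (op v) h)
    proj_surjective := proj_surjective v
    exact := by
      ext x
      constructor
      · intro hx
        obtain ⟨z, hz⟩ := exists_incl_eq (x := 1) (y := x)
          ((map_one (proj v)).trans (MonoidHom.mem_ker.1 hx).symm)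
        exact ⟨z, by rw [hz, one_mul]⟩
      · rintro ⟨z, rfl⟩
        exact proj_incl z
    central := fun z x => by
      refine ext (by simp) ?_
      ext φ
      simp
    locally_trivial := fun g => by
      obtain ⟨x, rfl⟩ := proj_surjective v g
      refine ⟨trivialization v (op v x v.vec), mem_triv_op_source x, fun y hy z => ?_, ?_, ?_⟩
      · refine Prod.ext (show proj v (y * incl v z) = proj v y by simp) ?_
        change phase (inner ℂ (op v x v.vec) (op v (y * incl v z) v.vec)) =
          phase (inner ℂ (op v x v.vec) (op v y v.vec)) * z
        rw [op_mul_incl, inner_smul_right, phase_mul _ (mem_triv_source.1 hy), mul_comm]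
      · exact (isSmoothMapOn_iff (triv v _).open_source).2 fun y hy => mSmoothAt_triv hy
      · exact (isSmoothMapOn_iff (triv v _).open_target).2 fun p hp => mSmoothAt_triv_symm hp }

theorem linearizes (hρ : IsSmoothProjRep E ρ) : (extension v hρ).Linearizes (op v) ρ where
  smooth := isSmoothRep_op hρ
  map_incl := op_incl
  induces := induces

end Pullback

/-! ### Existence of linearisations, including the zero space. -/

theorem exists_smoothRay [Nontrivial H] (hρ : IsSmoothProjRep E ρ) : Nonempty (SmoothRay E ρ) := by
  obtain ⟨ψ, hψ⟩ := exists_ne (0 : H)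
  obtain ⟨_, c, -⟩ := (dense_smoothRay hρ hψ).nonempty
  exact ⟨c⟩

theorem isSmoothProjRep_one : IsSmoothProjRep E (1 : G →* PU H) := by
  have h : ∀ p : ℙ ℂ H, IsSmoothToRays E (fun g : G => ((1 : G →* PU H) g).act p) := by
    intro p
    refine ⟨continuous_const, fun e _ ψ _ => ?_⟩
    have h1 : IsOpen (e.target ∩ e.symm ⁻¹' ((fun g : G => ((1 : G →* PU H) g).act p) ⁻¹'
        affineDomain ψ)) :=
      e.isOpen_inter_preimage_symm ((isOpen_affineDomain ψ).preimage continuous_const)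
    exact (isSmoothOn_iff_smoothAt h1).2 fun y _ =>
      smoothAt_const (affineChart ψ ((1 : PU H).act p)) y
  rw [IsSmoothProjRep, show {p | IsSmoothToRays E (fun g : G => ((1 : G →* PU H) g).act p)} = univ
    from eq_univ_of_forall h]
  exact dense_univ

theorem exists_linearizes (hρ : IsSmoothProjRep E ρ) :
    ∃ (X : CentralExtension.{max u w, v} E G) (r : X.Total →* (H ≃ₗᵢ[ℂ] H)),
      X.Linearizes r ρ := by
  rcases subsingleton_or_nontrivial H with hH | hH
  -- The zero space has no rays from which to build an extension. The extension is taken from the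
  -- trivial projective representation on a one-dimensional space in the universe of `H`, and it
  -- acts on `H` trivially.
  · obtain ⟨v⟩ := exists_smoothRay
      (isSmoothProjRep_one (E := E) (G := G) (H := EuclideanSpace ℂ PUnit.{w + 1}))
    refine ⟨Pullback.extension v isSmoothProjRep_one, 1, ?_, fun z => ?_, fun x => ?_⟩
    · refine dense_iff_inter_open.2 fun A _ ⟨a, ha⟩ => ⟨a, ha, ?_⟩
      exact isSmoothMap_iff.2 fun x => mSmoothAt_const a x
    · ext φ
      exact Subsingleton.elim _ _
    · obtain ⟨V, hV⟩ := QuotientGroup.mk_surjective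
        (ρ ((Pullback.extension v isSmoothProjRep_one).proj x))
      rw [← hV]
      congr 1
      ext φ
      exact Subsingleton.elim _ _
  · obtain ⟨v⟩ := exists_smoothRay hρ
    exact ⟨Pullback.extension v hρ, Pullback.op v, Pullback.linearizes hρ⟩

end Pullback

end LCLie

end

theorem corollary4p6
    {E : Type v} [AddCommGroup E] [Module ℝ E] [TopologicalSpace E]
    [IsTopologicalAddGroup E] [ContinuousSMul ℝ E] [LocallyConvexSpace ℝ E] [T2Space E]
    {G : Type u} [Group G] [TopologicalSpace G] [ChartedSpace E G] [LCLie.LCLieGroup E G]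
    {H : Type w} [NormedAddCommGroup H] [InnerProductSpace ℂ H] [CompleteSpace H]
    (ρ : G →* LCLie.PU H) (hρ : LCLie.IsSmoothProjRep E ρ) :
    (∃ (X : LCLie.CentralExtension.{max u w, v} E G) (r : X.Total →* (H ≃ₗᵢ[ℂ] H)),
      X.Linearizes r ρ) ∧
    (Nontrivial H →
      ∀ {H' : Type w'} [NormedAddCommGroup H'] [InnerProductSpace ℂ H'] [CompleteSpace H']
        (ρ' : G →* LCLie.PU H'), LCLie.IsSmoothProjRep E ρ' →
      ∀ (X : LCLie.CentralExtension.{u₁, u₂} E G) (r : X.Total →* (H ≃ₗᵢ[ℂ] H)),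
        X.Linearizes r ρ →
      ∀ (X' : LCLie.CentralExtension.{u₃, u₄} E G) (r' : X'.Total →* (H' ≃ₗᵢ[ℂ] H')),
        X'.Linearizes r' ρ' →
      (LCLie.ProjUnitarilyEquivalent ρ ρ' ↔
        ∃ (U : H ≃ₗᵢ[ℂ] H') (Φ : X.Iso X'),
          ∀ (x : X.Total) (ψ : H), U (r x ψ) = r' (Φ.toMulEquiv x) (U ψ))) := by
  exact ⟨LCLie.exists_linearizes hρ, fun _ _ _ _ _ _ _ _ _ hX _ _ hX' =>
    LCLie.projUnitarilyEquivalent_iff hX hX'⟩
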